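/- Let $N_\alpha,N_\beta\ge 1$, let $S_\alpha=\{e^\alpha_1,\dots,e^\alpha_{N_\alpha}\}$ and $S_\beta=\{e^\beta_1,\dots,e^\beta_{N_\beta}\}$ be disjoint sets of (pre-change and post-change) states, and identify $S_\alpha\cup S_\beta$ with the standard unit vectors of $\mathbb R^{N_\alpha+N_\beta}$. Let $A_\alpha\in\mathbb R^{N_\alpha\times N_\alpha}$, $A_\nu\in\mathbb R^{N_\beta\times N_\alpha}$, $A_\beta\in\mathbb R^{N_\beta\times N_\beta}$ be column-stochastic matrices, let $b_\alpha(\cdot,e_i^\alpha)$ and $b_\beta(\cdot,e_i^\beta)$ be probability densities with respect to a $\sigma$-finite measure on the observation space, let $\rho:S_\alpha\to(0,1)$, and let $c>0$. For an initial distribution $p$ on $S_\alpha$ and $k\ge1$, let $P_k$ be the law of a process $X_0,X_1,\dots$ with observations $y_1,y_2,\dots$ whose change time is $\nu=k$: $X_0\sim p$; the transition from $X_{\ell-1}$ to $X_\ell$ follows $A_\alpha$ (within $S_\alpha$) for $\ell<k$, $A_\nu$ (from $S_\alpha$ to $S_\beta$) for $\ell=k$, and $A_\beta$ (within $S_\beta$)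 for $\ell>k$ (the entry $(i,j)$ being the probability of moving from state $j$ to state $i$); and, given the state path, the $y_\ell$, $\ell\ge1$, are independent with density $b_\alpha(\cdot,X_\ell)$ if $\ell<k$ and $b_\beta(\cdot,X_\ell)$ if $\ell\ge k$. The change time $\nu$ has the state-dependent prior $$\pi_k=\rho(X_{k-1})\prod_{\ell=1}^{k-1}\bigl(1-\rho(X_{\ell-1})\bigr)\quad(k\ge1),\qquad \pi_0=0,$$ and $P_\pi$ is the resulting joint law of $(\nu,X,y)$, that is, $P_\pi(\{\nu=k\}\cap G)=E_k[\pi_k\mathbf 1_G]$ for every event $G$ determined by $(X,y)$, where $E_k$ is the expectation under $P_k$. Let $\mathcal Y_k=\sigma(y_1,\dots,y_k)$ ($\mathcal Y_0$ trivial), and let $\hat Z_k\in\mathbb R^{N_\alpha+N_\beta}$ be the posterior (HMM filter) with coordinates $\hat Z_k^s=P_\pi(X_k=s\mid\mathcal Y_k)$, $s\in S_\alpha\cup S_\beta$ (any $\mathcal Y_k$-measurable version). For a stopping time $\tau$ of $(\mathcal Y_k)_{k\ge0}$ with values in $\{0,1,2,\dots\}\cup\{\infty\}$ let $$J(\tau)=c\,E_\pi\bigl[(\tau-\nu)^+\bigr]+P_\pi(\tau<\nu)\in[0,\infty].$$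 Then there is a convex subset $\mathcal R_S$ of the probability simplex of $\mathbb R^{N_\alpha+N_\beta}$, which contains $e_i^\beta$ for every $i\in\{1,\dots,N_\beta\}$ and does not depend on $p$, such that for every initial distribution $p$ on $S_\alpha$ $$\tau^*=\inf\{k\ge0:\hat Z_k\in\mathcal R_S\}\qquad(\inf\emptyset=\infty)$$ is a stopping time of $(\mathcal Y_k)$ and $J(\tau^*)\le J(\tau)$ for every stopping time $\tau$ of $(\mathcal Y_k)$. -/

import Mathlib

open MeasureTheory

noncomputable section

namespace HMMQCD

/-- The states of both regimes: `Sum.inl i` is the pre-change state `e_i^α` and `Sum.inr i` the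
post-change state `e_i^β`.  Indicator vectors and probability vectors of the augmented chain are
elements of `State Nα Nβ → ℝ`, i.e. of `ℝ^(Nα + Nβ)`. -/
abbrev State (Nα Nβ : ℕ) : Type := Fin Nα ⊕ Fin Nβ

/-- Parameters of the change detection problem.  Transition matrices are column stochastic:
the entry `(i, j)` is the probability of moving from `j` to `i`.  Observation densities are taken
with respect to the reference measure `lam`. -/
structure Model (Nα Nβ : ℕ) {Y : Type*} [MeasurableSpace Y] (lam : Measure Y) where
  /-- pre-change transition matrix -/
  Aα : Matrix (Fin Nα) (Fin Nα) ℝ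
  /-- transition matrix at the change time -/
  Aν : Matrix (Fin Nβ) (Fin Nα) ℝ
  /-- post-change transition matrix -/
  Aβ : Matrix (Fin Nβ) (Fin Nβ) ℝ
  /-- pre-change observation densities -/
  bα : Y → Fin Nα → ℝ
  /-- post-change observation densities -/
  bβ : Y → Fin Nβ → ℝ
  /-- probability that the change happens in the next step, given the current pre-change state -/
  ρ : Fin Nα → ℝ
  Aα_nonneg : ∀ i j, 0 ≤ Aα i j
  Aα_sum : ∀ j, ∑ i, Aα i j = 1
  Aν_nonneg : ∀ i j, 0 ≤ Aν i j
  Aν_sum : ∀ j, ∑ i, Aν i j = 1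
  Aβ_nonneg : ∀ i j, 0 ≤ Aβ i j
  Aβ_sum : ∀ j, ∑ i, Aβ i j = 1
  bα_measurable : ∀ i, Measurable fun y => bα y i
  bα_nonneg : ∀ y i, 0 ≤ bα y i
  bα_lintegral : ∀ i, ∫⁻ y, ENNReal.ofReal (bα y i) ∂lam = 1
  bβ_measurable : ∀ i, Measurable fun y => bβ y i
  bβ_nonneg : ∀ y i, 0 ≤ bβ y i
  bβ_lintegral : ∀ i, ∫⁻ y, ENNReal.ofReal (bβ y i) ∂lam = 1
  ρ_pos : ∀ i, 0 < ρ i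
  ρ_lt_one : ∀ i, ρ i < 1

variable {Nα Nβ : ℕ} {Y : Type*} [MeasurableSpace Y] {lam : Measure Y}

namespace Model

/-- Probability of moving from `s` at time `l - 1` to `t` at time `l` when the change time is `k`. -/
def step (m : Model Nα Nβ lam) (k l : ℕ) : State Nα Nβ → State Nα Nβ → ℝ
  | .inl j, .inl i => if l < k then m.Aα i j else 0
  | .inl j, .inr i => if l = k then m.Aν i j else 0
  | .inr j, .inr i => if k < l then m.Aβ i j else 0
  | .inr _, .inl _ => 0

/-- Observation density in a state. -/
def obs (m : Model Nα Nβ lam) (s : State Nα Nβ) (y : Y) : ℝ :=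
  Sum.elim (m.bα y) (m.bβ y) s

/-- The initial law `p₀` on the pre-change states, extended by zero. -/
def init (p₀ : Fin Nα → ℝ) : State Nα Nβ → ℝ := Sum.elim p₀ fun _ => 0

/-- The `P_k`-probability (change at the fixed time `k`) that the state path is `x 0, …, x n`
and that `y_l ∈ B l` for `1 ≤ l ≤ n`: the integral over `B 1 × ⋯ × B n` of the joint density
`p(x 0) ∏_{l=1}^n step(x (l-1), x l) b(y_l, x l)`. -/
def pathProb (m : Model Nα Nβ lam) (p₀ : Fin Nα → ℝ) (k n : ℕ) (x : ℕ → State Nα Nβ)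
    (B : ℕ → Set Y) : ENNReal :=
  ENNReal.ofReal (init p₀ (x 0)) *
    ∏ l ∈ Finset.Icc 1 n,
      ENNReal.ofReal (m.step k l (x (l - 1)) (x l)) *
        ∫⁻ y in B l, ENNReal.ofReal (m.obs (x l) y) ∂lam

/-- `ρ` as a function on all states; the value at post-change states is never relevant, since
`prior k` is only evaluated on paths that are pre-change before time `k`. -/
def rho (m : Model Nα Nβ lam) : State Nα Nβ → ℝ := Sum.elim m.ρ fun _ => 0

/-- The path dependent geometric prior
`π_k(x) = ρ(x_{k-1}) ∏_{l=1}^{k-1} (1 - ρ(x_{l-1}))` for `k ≥ 1`, and `π_0 = 0`. -/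
def prior (m : Model Nα Nβ lam) (k : ℕ) (x : ℕ → State Nα Nβ) : ℝ :=
  if k = 0 then 0
  else m.rho (x (k - 1)) * ∏ l ∈ Finset.Icc 1 (k - 1), (1 - m.rho (x (l - 1)))

end Model

/-- `(ν, X, y)` is, under `P`, a change time, state process and observation process with law
`P_π = ∑_k π_k P_k`.  Observations are `y 1, y 2, …`; `y 0` plays no role. The finite-dimensional
identities for `n ≥ k` determine the joint law of `(ν, X, (y_k)_{k ≥ 1})`. -/
structure IsProcess (m : Model Nα Nβ lam) (p₀ : Fin Nα → ℝ)
    {Ω : Type*} [MeasurableSpace Ω] (P : Measure Ω)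
    (ν : Ω → ℕ) (X : ℕ → Ω → State Nα Nβ) (y : ℕ → Ω → Y) : Prop where
  measurable_ν : Measurable ν
  measurable_X : ∀ k, Measurable (X k)
  measurable_y : ∀ k, Measurable (y k)
  law : ∀ (k n : ℕ), k ≤ n → ∀ (x : ℕ → State Nα Nβ) (B : ℕ → Set Y),
    (∀ l, MeasurableSet (B l)) →
    P {ω | ν ω = k ∧ (∀ l ≤ n, X l ω = x l) ∧ ∀ l ∈ Finset.Icc 1 n, y l ω ∈ B l} =
      ENNReal.ofReal (m.prior k x) * m.pathProb p₀ k n x B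

/-- The observation filtration `𝒴_k = σ(y_1, …, y_k)`; `𝒴_0` is trivial. -/
def obsFiltration {Ω : Type*} [mΩ : MeasurableSpace Ω] (y : ℕ → Ω → Y)
    (hy : ∀ k, Measurable (y k)) : Filtration ℕ mΩ where
  seq k := ⨆ l ∈ Finset.Icc 1 k, MeasurableSpace.comap (y l) inferInstance
  mono' := fun _ _ hij =>
    biSup_mono fun _ hl => Finset.Icc_subset_Icc_right hij hl
  le' := fun _ => iSup₂_le fun l _ => (hy l).comap_le

/-- `Zhat` is a version of the posterior `Zhat_k^s = P(Z_k = s | y_1, …, y_k)`, where the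
augmented chain `Z_k` is `X_k` seen as an element of the union of the two state spaces. -/
structure IsPosterior {Ω : Type*} [mΩ : MeasurableSpace Ω] (P : Measure Ω)
    (𝒴 : Filtration ℕ mΩ) (X : ℕ → Ω → State Nα Nβ)
    (Zhat : ℕ → Ω → State Nα Nβ → ℝ) : Prop where
  adapted : ∀ k s, Measurable[𝒴 k] fun ω => Zhat k ω s
  ae_eq : ∀ k s,
    (fun ω => Zhat k ω s) =ᵐ[P] P[Set.indicator {ω | X k ω = s} (fun _ => (1 : ℝ)) | 𝒴 k]

/-- The cost `J(τ) = c E[(τ - ν)^+] + P(τ < ν)`, with values in `[0, ∞]`.  Subtraction in `ℕ∞` is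
truncated at zero, and `⊤ - ν = ⊤`. -/
def cost {Ω : Type*} [MeasurableSpace Ω] (P : Measure Ω) (c : ℝ) (ν : Ω → ℕ) (τ : Ω → ℕ∞) :
    ENNReal :=
  ENNReal.ofReal c * ∫⁻ ω, ((τ ω - (ν ω : ℕ∞) : ℕ∞) : ENNReal) ∂P + P {ω | τ ω < (ν ω : ℕ∞)}

/-- `inf {k ≥ 0 : Zhat_k ∈ R}`, with `inf ∅ = ∞`. -/
def entryTime {Ω E : Type*} (Zhat : ℕ → Ω → E) (R : Set E) (ω : Ω) : ℕ∞ :=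
  ⨅ (k : ℕ) (_ : Zhat k ω ∈ R), (k : ℕ∞)

end HMMQCD

end

open HMMQCD

/-! Mixing the laws `P_k` over the state-dependent prior turns `X` into a time-homogeneous hidden
Markov chain on both regimes, with transition weights `(1-ρ)A_α`, `ρA_ν`, `A_β`
(`measure_pathEvent`), and almost surely `ν ≤ n` iff `X n` is a post-change state
(`ae_change_le_iff`). The cost of `τ` then becomes a sum over times `k` of `c P(k < τ, X k post)`
and `P(τ = k, X k pre)` (`cost_eq_tsum`). Both are integrals over observable events of linear
functions of the posterior, so this is a Markovian stopping problem for the filter.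

Its value function is defined on unnormalised weights in `[0, ∞]`, as the infimum of finite-horizon
value iterations. In this form it is homogeneous and superadditive, which together replace
concavity, and the normalising constant of Bayes' rule cancels. It lies below the linear stopping
cost `preMass`; hence the set where the two agree is convex. It contains each post-change vertex,
where both vanish. The construction involves neither the initial law nor the probability space.

Optimality is a verification argument. By the Bellman equation (`value_eq_min`) and the one-step
formula `setLIntegral_value_succ`, the expected initial value is at most the cost of `τ` up to time
`n` plus a remainder, with equality for the entry time. The remainder is at most `P(n < ν)`, which
tends to zero because `ν` is finite. -/

noncomputable section

namespace HMMQCD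

variable {Nα Nβ : ℕ} {Y : Type*} [MeasurableSpace Y] {lam : Measure Y}

/-! ### Value iteration on unnormalised filters. -/

/-- Total mass of the pre-change states. -/
def preMass (q : State Nα Nβ → ENNReal) : ENNReal := ∑ i, q (Sum.inl i)

/-- Total mass of the post-change states. -/
def postMass (q : State Nα Nβ → ENNReal) : ENNReal := ∑ i, q (Sum.inr i)

lemma measurable_preMass : Measurable (preMass : (State Nα Nβ → ENNReal) → ENNReal) := by
  unfold preMass; fun_prop

lemma measurable_postMass : Measurable (postMass : (State Nα Nβ → ENNReal) → ENNReal) := by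
  unfold postMass; fun_prop

lemma preMass_add (q r : State Nα Nβ → ENNReal) : preMass (q + r) = preMass q + preMass r := by
  simp [preMass, Finset.sum_add_distrib]

lemma postMass_add (q r : State Nα Nβ → ENNReal) : postMass (q + r) = postMass q + postMass r := by
  simp [postMass, Finset.sum_add_distrib]

lemma preMass_smul (a : ENNReal) (q : State Nα Nβ → ENNReal) :
    preMass (a • q) = a * preMass q := by
  simp [preMass, Finset.mul_sum]

lemma postMass_smul (a : ENNReal) (q : State Nα Nβ → ENNReal) :
    postMass (a • q) = a * postMass q := by
  simp [postMass, Finset.mul_sum]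

namespace Model

/-- Transition probabilities, from `s` to `t`, of the augmented chain on both regimes. -/
def trans (m : Model Nα Nβ lam) : State Nα Nβ → State Nα Nβ → ENNReal
  | .inl j, .inl i => ENNReal.ofReal ((1 - m.ρ j) * m.Aα i j)
  | .inl j, .inr i => ENNReal.ofReal (m.ρ j * m.Aν i j)
  | .inr j, .inr i => ENNReal.ofReal (m.Aβ i j)
  | .inr _, .inl _ => 0

/-- One step of the unnormalised filter: prediction by the augmented chain, followed by weighting
with the observation density. -/
def update (m : Model Nα Nβ lam) (q : State Nα Nβ → ENNReal) (y : Y) : State Nα Nβ → ENNReal :=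
  fun t => ENNReal.ofReal (m.obs t y) * ∑ s, m.trans s t * q s

lemma trans_ne_top (m : Model Nα Nβ lam) (s t : State Nα Nβ) : m.trans s t ≠ ⊤ := by
  rcases s with s | s <;> rcases t with t | t <;> simp [trans]

lemma measurable_obs (m : Model Nα Nβ lam) (s : State Nα Nβ) : Measurable (m.obs s) := by
  rcases s with s | s
  · exact m.bα_measurable s
  · exact m.bβ_measurable s

lemma lintegral_obs (m : Model Nα Nβ lam) (s : State Nα Nβ) :
    ∫⁻ y, ENNReal.ofReal (m.obs s y) ∂lam = 1 := by
  rcases s with s | s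
  · exact m.bα_lintegral s
  · exact m.bβ_lintegral s

lemma measurable_update (m : Model Nα Nβ lam) :
    Measurable fun p : (State Nα Nβ → ENNReal) × Y => m.update p.1 p.2 := by
  have := m.measurable_obs
  unfold update
  fun_prop

lemma update_add (m : Model Nα Nβ lam) (q r : State Nα Nβ → ENNReal) (y : Y) :
    m.update (q + r) y = m.update q y + m.update r y := by
  ext t
  simp [update, mul_add, Finset.sum_add_distrib]

lemma update_smul (m : Model Nα Nβ lam) (a : ENNReal) (q : State Nα Nβ → ENNReal) (y : Y) :
    m.update (a • q) y = a • m.update q y := by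
  ext t
  simp only [update, Pi.smul_apply, smul_eq_mul, Finset.mul_sum]
  exact Finset.sum_congr rfl fun s _ => by ring

lemma update_ne_top (m : Model Nα Nβ lam) {q : State Nα Nβ → ENNReal} (hq : ∀ s, q s ≠ ⊤) (y : Y)
    (t : State Nα Nβ) : m.update q y t ≠ ⊤ :=
  ENNReal.mul_ne_top ENNReal.ofReal_ne_top
    (ENNReal.sum_ne_top.2 fun s _ => ENNReal.mul_ne_top (m.trans_ne_top s t) (hq s))

/-- Cost of continuing for one step from `q` when `φ` is the cost from then on. -/
def contCost (m : Model Nα Nβ lam) (c : ENNReal) (φ : (State Nα Nβ → ENNReal) → ENNReal)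
    (q : State Nα Nβ → ENNReal) : ENNReal :=
  c * postMass q + ∫⁻ y, φ (m.update q y) ∂lam

/-- Optimal cost, as a function of the unnormalised filter, of stopping within `n` steps. -/
def valueWithin (m : Model Nα Nβ lam) (c : ENNReal) : ℕ → (State Nα Nβ → ENNReal) → ENNReal
  | 0 => preMass
  | n + 1 => fun q => min (preMass q) (m.contCost c (m.valueWithin c n) q)

/-- Optimal cost as a function of the unnormalised filter. -/
def value (m : Model Nα Nβ lam) (c : ENNReal) (q : State Nα Nβ → ENNReal) : ENNReal :=
  ⨅ n, m.valueWithin c n q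

lemma contCost_mono (m : Model Nα Nβ lam) (c : ENNReal)
    {φ ψ : (State Nα Nβ → ENNReal) → ENNReal} (h : φ ≤ ψ) : m.contCost c φ ≤ m.contCost c ψ :=
  fun _ => add_le_add le_rfl (lintegral_mono fun _ => h _)

lemma measurable_contCost [SFinite lam] (m : Model Nα Nβ lam) (c : ENNReal)
    {φ : (State Nα Nβ → ENNReal) → ENNReal} (h : Measurable φ) : Measurable (m.contCost c φ) := by
  unfold contCost
  exact (measurable_postMass.const_mul c).add (h.comp m.measurable_update).lintegral_prod_right'

lemma measurable_valueWithin [SFinite lam] (m : Model Nα Nβ lam) (c : ENNReal) (n : ℕ) :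
    Measurable (m.valueWithin c n) := by
  induction n with
  | zero => exact measurable_preMass
  | succ n ih => exact measurable_preMass.min (m.measurable_contCost c ih)

lemma measurable_value [SFinite lam] (m : Model Nα Nβ lam) (c : ENNReal) :
    Measurable (m.value c) :=
  Measurable.iInf fun n => m.measurable_valueWithin c n

lemma value_le_preMass (m : Model Nα Nβ lam) (c : ENNReal) (q : State Nα Nβ → ENNReal) :
    m.value c q ≤ preMass q :=
  iInf_le_of_le 0 le_rfl

lemma antitone_valueWithin (m : Model Nα Nβ lam) (c : ENNReal) :
    Antitone (m.valueWithin c) := by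
  refine antitone_nat_of_succ_le fun n => ?_
  induction n with
  | zero => exact fun q => min_le_left _ _
  | succ n ih => exact fun q => min_le_min le_rfl (m.contCost_mono c ih q)

lemma valueWithin_smul [SFinite lam] (m : Model Nα Nβ lam) (c : ENNReal) (n : ℕ) (a : ENNReal)
    (q : State Nα Nβ → ENNReal) : m.valueWithin c n (a • q) = a * m.valueWithin c n q := by
  induction n generalizing q with
  | zero => exact preMass_smul a q
  | succ n ih =>
    have hm : Measurable fun y => m.valueWithin c n (m.update q y) :=
      (m.measurable_valueWithin c n).comp (m.measurable_update.comp measurable_prodMk_left)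
    have h : m.contCost c (m.valueWithin c n) (a • q) =
        a * m.contCost c (m.valueWithin c n) q := by
      simp only [contCost, postMass_smul, update_smul, ih]
      rw [lintegral_const_mul _ hm]
      ring
    simp only [valueWithin, preMass_smul, h]
    exact (mul_right_mono (a := a)).map_min.symm

/-- Finiteness of `a` is essential: multiplication by `⊤` does not commute with the infimum over
horizons. -/
lemma value_smul [SFinite lam] (m : Model Nα Nβ lam) (c : ENNReal) {a : ENNReal} (ha : a ≠ ⊤)
    (q : State Nα Nβ → ENNReal) : m.value c (a • q) = a * m.value c q := by
  simp only [value, valueWithin_smul]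
  exact (ENNReal.mul_iInf fun h => absurd h ha).symm

/-- Concavity in homogeneous form: the update and both mass functionals are additive, and a minimum
of superadditive functions is superadditive. -/
lemma valueWithin_superadditive [SFinite lam] (m : Model Nα Nβ lam) (c : ENNReal) (n : ℕ)
    (q r : State Nα Nβ → ENNReal) :
    m.valueWithin c n q + m.valueWithin c n r ≤ m.valueWithin c n (q + r) := by
  induction n generalizing q r with
  | zero => exact (preMass_add q r).ge
  | succ n ih =>
    have hm : Measurable fun y => m.valueWithin c n (m.update q y) :=
      (m.measurable_valueWithin c n).comp (m.measurable_update.comp measurable_prodMk_left)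
    refine le_min ?_ ?_
    · rw [preMass_add]
      exact add_le_add (min_le_left _ _) (min_le_left _ _)
    · refine (add_le_add (min_le_right _ _) (min_le_right _ _)).trans ?_
      simp only [contCost, postMass_add, update_add]
      calc c * postMass q + ∫⁻ y, m.valueWithin c n (m.update q y) ∂lam +
            (c * postMass r + ∫⁻ y, m.valueWithin c n (m.update r y) ∂lam)
          = c * (postMass q + postMass r) + ∫⁻ y, (m.valueWithin c n (m.update q y) +
              m.valueWithin c n (m.update r y)) ∂lam := by
            rw [lintegral_add_left hm]; ring
        _ ≤ _ := add_le_add le_rfl (lintegral_mono fun y => ih _ _)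

lemma value_superadditive [SFinite lam] (m : Model Nα Nβ lam) (c : ENNReal)
    (q r : State Nα Nβ → ENNReal) : m.value c q + m.value c r ≤ m.value c (q + r) :=
  le_iInf fun n => (add_le_add (iInf_le _ n) (iInf_le _ n)).trans
    (m.valueWithin_superadditive c n q r)

lemma lintegral_preMass_update_ne_top (m : Model Nα Nβ lam) {q : State Nα Nβ → ENNReal}
    (hq : ∀ s, q s ≠ ⊤) : ∫⁻ y, preMass (m.update q y) ∂lam ≠ ⊤ := by
  have hm := m.measurable_obs
  simp only [preMass, update]
  rw [lintegral_finsetSum _ (fun i _ => by fun_prop)]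
  refine ENNReal.sum_ne_top.2 fun i _ => ?_
  rw [lintegral_mul_const _ (by fun_prop), m.lintegral_obs, one_mul]
  exact ENNReal.sum_ne_top.2 fun s _ => ENNReal.mul_ne_top (m.trans_ne_top s _) (hq s)

/-- The Bellman equation. -/
lemma value_eq_min [SFinite lam] (m : Model Nα Nβ lam) (c : ENNReal)
    {q : State Nα Nβ → ENNReal} (hq : ∀ s, q s ≠ ⊤) :
    m.value c q = min (preMass q) (m.contCost c (m.value c) q) := by
  -- Monotone convergence for a decreasing sequence needs one finite integral: that of the
  -- horizon-zero cost `preMass`, finite because `q` is.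
  have hint : ∫⁻ y, m.value c (m.update q y) ∂lam =
      ⨅ n, ∫⁻ y, m.valueWithin c n (m.update q y) ∂lam :=
    lintegral_iInf
      (fun n => (m.measurable_valueWithin c n).comp (m.measurable_update.comp measurable_prodMk_left))
      (fun i j hij y => m.antitone_valueWithin c hij _) (m.lintegral_preMass_update_ne_top hq)
  refine le_antisymm (le_min (m.value_le_preMass c q) ?_) (le_iInf fun n => ?_)
  · rw [contCost, hint, ENNReal.add_iInf]
    exact le_iInf fun n => iInf_le_of_le (n + 1) (min_le_right _ _)
  · cases n with
    | zero => exact min_le_left _ _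
    | succ n => exact min_le_min le_rfl (m.contCost_mono c (fun r => iInf_le _ n) q)

end Model

/-! ### Bayes' rule for one filter step. -/

lemma lintegral_eq_sum_fiber {Ω ι : Type*} [MeasurableSpace Ω] [Fintype ι] (P : Measure Ω)
    {X : Ω → ι} (hX : ∀ t, MeasurableSet {ω | X ω = t}) {f : Ω → ENNReal} (hf : Measurable f) :
    ∫⁻ ω, f ω ∂P = ∑ t, ∫⁻ ω in {ω | X ω = t}, f ω ∂P := by
  classical
  simp_rw [← lintegral_indicator (hX _)]
  rw [← lintegral_finsetSum _ fun t _ => hf.indicator (hX t)]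
  refine lintegral_congr fun ω => ?_
  simp [Set.indicator_apply]

lemma measure_eq_sum_fiber {Ω ι : Type*} [MeasurableSpace Ω] [Fintype ι] (P : Measure Ω)
    {X : Ω → ι} (hX : ∀ t, MeasurableSet {ω | X ω = t}) (A : Set Ω) :
    P A = ∑ t, P (A ∩ {ω | X ω = t}) := by
  have h := lintegral_eq_sum_fiber (P.restrict A) hX (f := fun _ => 1) measurable_const
  simp only [lintegral_one, Measure.restrict_apply_univ, Measure.restrict_apply (hX _)] at h
  simpa [Set.inter_comm] using h

namespace Model

/-- The filter step, normalised to total mass one. -/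
def normalizedUpdate (m : Model Nα Nβ lam) (q : State Nα Nβ → ENNReal) (y : Y) :
    State Nα Nβ → ENNReal :=
  (∑ t, m.update q y t)⁻¹ • m.update q y

lemma measurable_normalizedUpdate (m : Model Nα Nβ lam) :
    Measurable fun p : (State Nα Nβ → ENNReal) × Y => m.normalizedUpdate p.1 p.2 := by
  have h := m.measurable_update
  refine measurable_pi_lambda _ fun t => ?_
  have h' : ∀ t, Measurable fun p : (State Nα Nβ → ENNReal) × Y => m.update p.1 p.2 t :=
    fun t => (measurable_pi_apply t).comp h
  simp only [normalizedUpdate, Pi.smul_apply, smul_eq_mul]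
  fun_prop

/-- Division by the total mass is harmless even where that mass is zero, since all coordinates of
the update vanish there. -/
lemma normalizedUpdate_mul_sum (m : Model Nα Nβ lam) {q : State Nα Nβ → ENNReal}
    (hq : ∀ s, q s ≠ ⊤) (y : Y) (t : State Nα Nβ) :
    (∑ u, m.update q y u) * m.normalizedUpdate q y t = m.update q y t := by
  have htop : ∑ u, m.update q y u ≠ ⊤ := ENNReal.sum_ne_top.2 fun u _ => m.update_ne_top hq y u
  rcases eq_or_ne (∑ u, m.update q y u) 0 with h | h
  · rw [h, zero_mul, Finset.sum_eq_zero_iff.1 h t (Finset.mem_univ t)]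
  · simp only [normalizedUpdate, Pi.smul_apply, smul_eq_mul]
    rw [← mul_assoc, ENNReal.mul_inv_cancel h htop, one_mul]

/-- Homogeneity moves the normalising constant out of the value, giving the form `G * update` that
`IsFilterStep.lintegral_eq` integrates. -/
lemma value_update_eq [SFinite lam] (m : Model Nα Nβ lam) (c : ENNReal)
    {q : State Nα Nβ → ENNReal} (hq : ∀ s, q s ≠ ⊤) (y : Y) :
    m.value c (m.update q y) =
      ∑ t, m.value c (m.normalizedUpdate q y) * m.update q y t := by
  have htop : ∑ u, m.update q y u ≠ ⊤ := ENNReal.sum_ne_top.2 fun u _ => m.update_ne_top hq y u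
  have h : m.update q y = (∑ u, m.update q y u) • m.normalizedUpdate q y :=
    funext fun t => (m.normalizedUpdate_mul_sum hq y t).symm
  rw [← Finset.mul_sum, mul_comm, ← m.value_smul c htop, ← h]

attribute [irreducible] normalizedUpdate

section FilterStep

variable {Ω S : Type*} [MeasurableSpace Ω] [MeasurableSpace S]

/-- Joint law of past information `π`, next observation `η` and next state `X'`, given that the
filter at the past information is `z ∘ π`. -/
structure IsFilterStep (m : Model Nα Nβ lam) (P : Measure Ω) (π : Ω → S) (η : Ω → Y)
    (X' : Ω → State Nα Nβ) (z : S → State Nα Nβ → ENNReal) : Prop where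
  measurable_past : Measurable π
  measurable_obs : Measurable η
  measurableSet_state : ∀ t, MeasurableSet {ω | X' ω = t}
  measurable_filter : Measurable z
  filter_ne_top : ∀ a s, z a s ≠ ⊤
  law : ∀ A, MeasurableSet A → ∀ B, MeasurableSet B → ∀ t,
    P ((π ⁻¹' A ∩ η ⁻¹' B) ∩ {ω | X' ω = t}) =
      (∫⁻ ω in π ⁻¹' A, ∑ s, m.trans s t * z (π ω) s ∂P) *
        ∫⁻ y in B, ENNReal.ofReal (m.obs t y) ∂lam

namespace IsFilterStep

variable {m : Model Nα Nβ lam} {P : Measure Ω} {π : Ω → S} {η : Ω → Y}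
  {X' : Ω → State Nα Nβ} {z : S → State Nα Nβ → ENNReal}

lemma measurable_update_filter (h : IsFilterStep m P π η X' z) (t : State Nα Nβ) :
    Measurable fun p : S × Y => m.update (z p.1) p.2 t :=
  (measurable_pi_apply t).comp
    (m.measurable_update.comp ((h.measurable_filter.comp measurable_fst).prodMk measurable_snd))

/-- On `{X' = t}` the pair `(π, η)` has density `update (z a) y t` with respect to the law of `π`
times `lam`; the law on rectangles determines this finite measure. -/
lemma setLIntegral_state [SigmaFinite lam] [IsFiniteMeasure P] (h : IsFilterStep m P π η X' z) {G : S × Y → ENNReal}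
    (hG : Measurable G) (t : State Nα Nβ) :
    ∫⁻ ω in {ω | X' ω = t}, G (π ω, η ω) ∂P =
      ∫⁻ ω, ∫⁻ y, G (π ω, y) * m.update (z (π ω)) y t ∂lam ∂P := by
  have hpair : Measurable fun ω => (π ω, η ω) := h.measurable_past.prodMk h.measurable_obs
  have hu := h.measurable_update_filter t
  have hz := h.measurable_filter
  have hobs := m.measurable_obs
  have key : (P.restrict {ω | X' ω = t}).map (fun ω => (π ω, η ω)) =
      ((P.map π).prod lam).withDensity fun p => m.update (z p.1) p.2 t := by
    refine Measure.ext_prod fun {A B} hA hB => ?_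
    rw [Measure.map_apply hpair (hA.prod hB),
      Measure.restrict_apply (hpair (hA.prod hB)), Set.mk_preimage_prod, h.law A hA B hB t,
      withDensity_apply _ (hA.prod hB), ← Measure.prod_restrict, lintegral_prod _ hu.aemeasurable]
    have : ∀ a, ∫⁻ y in B, m.update (z a) y t ∂lam =
        (∑ s, m.trans s t * z a s) * ∫⁻ y in B, ENNReal.ofReal (m.obs t y) ∂lam := by
      intro a
      simp only [update]
      rw [lintegral_mul_const _ (by fun_prop), mul_comm]
    simp only [this]
    rw [lintegral_mul_const _ (by fun_prop),
      setLIntegral_map hA (by fun_prop) h.measurable_past]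
  rw [← lintegral_map (μ := P.restrict {ω | X' ω = t}) hG hpair, key,
    lintegral_withDensity_eq_lintegral_mul _ hu hG, lintegral_prod _ (hu.mul hG).aemeasurable,
    lintegral_map (by exact (hu.mul hG).lintegral_prod_right') h.measurable_past]
  simp [mul_comm]

lemma lintegral_eq [SigmaFinite lam] [IsFiniteMeasure P] (h : IsFilterStep m P π η X' z) {G : S × Y → ENNReal} (hG : Measurable G) :
    ∫⁻ ω, G (π ω, η ω) ∂P =
      ∫⁻ ω, ∫⁻ y, ∑ t, G (π ω, y) * m.update (z (π ω)) y t ∂lam ∂P := by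
  have hpair : Measurable fun ω => (π ω, η ω) := h.measurable_past.prodMk h.measurable_obs
  have hm : ∀ t, Measurable fun p : S × Y => G p * m.update (z p.1) p.2 t :=
    fun t => hG.mul (h.measurable_update_filter t)
  rw [lintegral_eq_sum_fiber P h.measurableSet_state (f := fun ω => G (π ω, η ω))
    (hG.comp hpair)]
  simp only [h.setLIntegral_state hG]
  have hint : ∀ t, Measurable fun ω => ∫⁻ y, G (π ω, y) * m.update (z (π ω)) y t ∂lam :=
    fun t => (hm t).lintegral_prod_right'.comp h.measurable_past
  rw [← lintegral_finsetSum _ fun t _ => hint t]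
  exact lintegral_congr fun ω =>
    (lintegral_finsetSum _ fun t _ => (hm t).comp measurable_prodMk_left).symm

lemma measurable_normalizedUpdate_filter (h : IsFilterStep m P π η X' z) :
    Measurable fun p : S × Y => m.normalizedUpdate (z p.1) p.2 := by
  have hp : Measurable fun p : S × Y => (z p.1, p.2) :=
    (h.measurable_filter.comp measurable_fst).prodMk measurable_snd
  exact m.measurable_normalizedUpdate.comp hp

/-- Given the past, `η` has the total mass of the update as density; multiplied by the normalised
weight this is the unnormalised weight of `t`. -/
lemma setLIntegral_normalizedUpdate [SigmaFinite lam] [IsFiniteMeasure P] (h : IsFilterStep m P π η X' z) {C : Set (S × Y)}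
    (hC : MeasurableSet C) (t : State Nα Nβ) :
    ∫⁻ ω in (fun ω => (π ω, η ω)) ⁻¹' C, m.normalizedUpdate (z (π ω)) (η ω) t ∂P =
      P ((fun ω => (π ω, η ω)) ⁻¹' C ∩ {ω | X' ω = t}) := by
  have hpair : Measurable fun ω => (π ω, η ω) := h.measurable_past.prodMk h.measurable_obs
  have hk : Measurable fun p : S × Y => m.normalizedUpdate (z p.1) p.2 t :=
    (measurable_pi_apply t).comp h.measurable_normalizedUpdate_filter
  have h1 := h.lintegral_eq (hk.indicator hC)
  have h2 := h.setLIntegral_state (measurable_const.indicator hC : Measurable (C.indicator 1)) t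
  have e1 : (fun ω => C.indicator (fun p : S × Y => m.normalizedUpdate (z p.1) p.2 t) (π ω, η ω)) =
      ((fun ω => (π ω, η ω)) ⁻¹' C).indicator
        (fun ω => m.normalizedUpdate (z (π ω)) (η ω) t) := rfl
  have e2 : (fun ω => C.indicator (1 : S × Y → ENNReal) (π ω, η ω)) =
      ((fun ω => (π ω, η ω)) ⁻¹' C).indicator 1 := rfl
  rw [e1, lintegral_indicator (hpair hC)] at h1
  rw [e2, lintegral_indicator_one (hpair hC), Measure.restrict_apply (hpair hC)] at h2
  rw [h1, h2]
  refine lintegral_congr fun ω => lintegral_congr fun y => ?_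
  by_cases hy : (π ω, y) ∈ C
  · simp only [Set.indicator_of_mem hy, Pi.one_apply, one_mul]
    rw [← Finset.mul_sum, mul_comm]
    exact m.normalizedUpdate_mul_sum (h.filter_ne_top _) y t
  · simp [Set.indicator_of_notMem hy]

/-- A version of the posterior of the next state is given by the normalised filter step. -/
lemma ae_eq_normalizedUpdate [SigmaFinite lam] [IsFiniteMeasure P] (h : IsFilterStep m P π η X' z)
    {z' : Ω → State Nα Nβ → ENNReal} {t : State Nα Nβ}
    (hz' : Measurable[MeasurableSpace.comap (fun ω => (π ω, η ω)) inferInstance] fun ω => z' ω t)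
    (hlaw : ∀ C : Set (S × Y), MeasurableSet C →
      ∫⁻ ω in (fun ω => (π ω, η ω)) ⁻¹' C, z' ω t ∂P =
        P ((fun ω => (π ω, η ω)) ⁻¹' C ∩ {ω | X' ω = t})) :
    (fun ω => z' ω t) =ᵐ[P] fun ω => m.normalizedUpdate (z (π ω)) (η ω) t := by
  have hpair : Measurable fun ω => (π ω, η ω) := h.measurable_past.prodMk h.measurable_obs
  have hle := hpair.comap_le
  have hk : Measurable fun p : S × Y => m.normalizedUpdate (z p.1) p.2 t :=
    (measurable_pi_apply t).comp h.measurable_normalizedUpdate_filter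
  have hk' : Measurable[MeasurableSpace.comap (fun ω => (π ω, η ω)) inferInstance]
      fun ω => m.normalizedUpdate (z (π ω)) (η ω) t :=
    hk.comp (comap_measurable _)
  -- Both sides are measurable for the σ-algebra of `(π, η)`, so equal integrals over its sets
  -- suffice.
  refine ae_eq_of_ae_eq_trim (hm := hle)
    (ae_eq_of_forall_setLIntegral_eq_of_sigmaFinite hz' hk' ?_)
  intro s hs _
  rw [setLIntegral_trim hle hz' hs, setLIntegral_trim hle hk' hs]
  obtain ⟨C, hC, rfl⟩ := hs
  rw [hlaw C hC, h.setLIntegral_normalizedUpdate hC t]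

/-- Expected value of the optimal cost after one step. -/
lemma setLIntegral_value [SigmaFinite lam] [IsFiniteMeasure P] (h : IsFilterStep m P π η X' z) (c : ENNReal)
    {z' : Ω → State Nα Nβ → ENNReal}
    (hz' : ∀ t,
      Measurable[MeasurableSpace.comap (fun ω => (π ω, η ω)) inferInstance] fun ω => z' ω t)
    (hlaw : ∀ t, ∀ C : Set (S × Y), MeasurableSet C →
      ∫⁻ ω in (fun ω => (π ω, η ω)) ⁻¹' C, z' ω t ∂P =
        P ((fun ω => (π ω, η ω)) ⁻¹' C ∩ {ω | X' ω = t}))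
    {A : Set S} (hA : MeasurableSet A) :
    ∫⁻ ω in π ⁻¹' A, m.value c (z' ω) ∂P =
      ∫⁻ ω in π ⁻¹' A, ∫⁻ y, m.value c (m.update (z (π ω)) y) ∂lam ∂P := by
  have hae : ∀ᵐ ω ∂P, z' ω = m.normalizedUpdate (z (π ω)) (η ω) := by
    have := ae_all_iff.2 fun t => h.ae_eq_normalizedUpdate (hz' t) (hlaw t)
    filter_upwards [this] with ω hω using funext hω
  have hG : Measurable ((A ×ˢ (Set.univ : Set Y)).indicator
      fun p : S × Y => m.value c (m.normalizedUpdate (z p.1) p.2)) :=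
    ((m.measurable_value c).comp h.measurable_normalizedUpdate_filter).indicator
      (hA.prod MeasurableSet.univ)
  have hpA := h.measurable_past hA
  have h1 := h.lintegral_eq hG
  rw [setLIntegral_congr_fun_ae (g := fun ω => m.value c (m.normalizedUpdate (z (π ω)) (η ω))) hpA
    (hae.mono fun ω hω _ => by rw [hω]), ← lintegral_indicator hpA, ← lintegral_indicator hpA]
  convert h1 using 1
  · refine lintegral_congr fun ω => ?_
    by_cases hω : π ω ∈ A <;> simp [hω]
  · refine lintegral_congr fun ω => ?_
    by_cases hω : π ω ∈ A
    · simp [hω, m.value_update_eq c (h.filter_ne_top (π ω))]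
    · simp [hω]

end IsFilterStep

end FilterStep

end Model

/-! ### Path weights of the augmented chain and the law of the change time. -/

namespace Model

/-- Probability of an observation in `B`, given the state `s`. -/
def obsMass (m : Model Nα Nβ lam) (s : State Nα Nβ) (B : Set Y) : ENNReal :=
  ∫⁻ y in B, ENNReal.ofReal (m.obs s y) ∂lam

lemma obsMass_univ (m : Model Nα Nβ lam) (s : State Nα Nβ) : m.obsMass s Set.univ = 1 := by
  rw [obsMass, setLIntegral_univ, m.lintegral_obs]

/-- Probability that the augmented chain follows the path `x 0, …, x n` and that the observations
satisfy `y_l ∈ B l` for `1 ≤ l ≤ n`. -/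
def pathWeight (m : Model Nα Nβ lam) (p₀ : Fin Nα → ℝ) (n : ℕ) (x : ℕ → State Nα Nβ)
    (B : ℕ → Set Y) : ENNReal :=
  ENNReal.ofReal (init p₀ (x 0)) *
    ∏ l ∈ Finset.Icc 1 n, m.trans (x (l - 1)) (x l) * m.obsMass (x l) (B l)

section Congr

variable (m : Model Nα Nβ lam) (p₀ : Fin Nα → ℝ) {n : ℕ} {x x' : ℕ → State Nα Nβ}
  {B B' : ℕ → Set Y}

lemma pathWeight_congr (hx : ∀ l ≤ n, x l = x' l) (hB : ∀ l ≤ n, B l = B' l) :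
    m.pathWeight p₀ n x B = m.pathWeight p₀ n x' B' := by
  unfold pathWeight
  rw [hx 0 (Nat.zero_le n)]
  congr 1
  refine Finset.prod_congr rfl fun l hl => ?_
  have := Finset.mem_Icc.1 hl
  rw [hx l (by omega), hx (l - 1) (by omega), hB l (by omega)]

lemma pathWeight_succ (x : ℕ → State Nα Nβ) (B : ℕ → Set Y) :
    m.pathWeight p₀ (n + 1) x B =
      m.pathWeight p₀ n x B * (m.trans (x n) (x (n + 1)) * m.obsMass (x (n + 1)) (B (n + 1))) := by
  rw [pathWeight, Finset.prod_Icc_succ_top (by omega), pathWeight, mul_assoc]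
  rfl

lemma pathProb_succ {k : ℕ} (x : ℕ → State Nα Nβ) (B : ℕ → Set Y) :
    m.pathProb p₀ k (n + 1) x B = m.pathProb p₀ k n x B *
      (ENNReal.ofReal (m.step k (n + 1) (x n) (x (n + 1))) *
        m.obsMass (x (n + 1)) (B (n + 1))) := by
  rw [pathProb, Finset.prod_Icc_succ_top (by omega), pathProb, mul_assoc]
  rfl

end Congr

section PathLaw

variable (m : Model Nα Nβ lam) (p₀ : Fin Nα → ℝ)

lemma one_sub_rho_nonneg (s : State Nα Nβ) : 0 ≤ 1 - m.rho s := by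
  rcases s with s | s
  · exact sub_nonneg.2 (m.ρ_lt_one s).le
  · simp [rho]

lemma rho_nonneg (s : State Nα Nβ) : 0 ≤ m.rho s := by
  rcases s with s | s
  · exact (m.ρ_pos s).le
  · simp [rho]

/-- Before the change time, survival factors turn pre-change transitions into transitions of the
augmented chain. -/
lemma survival_mul_pathProb (x : ℕ → State Nα Nβ) (B : ℕ → Set Y) {n K : ℕ} (hnK : n < K) :
    ENNReal.ofReal (∏ l ∈ Finset.Icc 1 n, (1 - m.rho (x (l - 1)))) * m.pathProb p₀ K n x B =
      if (x n).isLeft then m.pathWeight p₀ n x B else 0 := by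
  induction n with
  | zero =>
    rcases h : x 0 with s | s <;> simp [pathProb, pathWeight, h, init]
  | succ n ih =>
    have ih := ih (by omega)
    rw [Finset.prod_Icc_succ_top (by omega), pathProb_succ, pathWeight_succ,
      ENNReal.ofReal_mul (Finset.prod_nonneg fun l _ => m.one_sub_rho_nonneg _), Nat.add_sub_cancel]
    rw [show ∀ a b c d e : ENNReal, a * b * (c * (d * e)) = (a * c) * (b * d * e) by
      intros; ring, ih]
    rcases h : x n with s | s <;> rcases h' : x (n + 1) with t | t
    · simp only [Sum.isLeft_inl, if_true, step, if_pos hnK, trans, rho, Sum.elim_inl]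
      rw [ENNReal.ofReal_mul (sub_nonneg.2 (m.ρ_lt_one s).le)]
    · simp [step, hnK.ne]
    · simp [trans]
    · simp

/-- The case distinction of `survival_mul_pathProb` disappears because `rho` is zero at post-change
states. -/
lemma prior_succ_mul_pathProb (x : ℕ → State Nα Nβ) (B : ℕ → Set Y) (n : ℕ) :
    ENNReal.ofReal (m.prior (n + 1) x) * m.pathProb p₀ (n + 1) (n + 1) x B =
      m.pathWeight p₀ n x B * (ENNReal.ofReal (m.rho (x n)) *
        (ENNReal.ofReal (m.step (n + 1) (n + 1) (x n) (x (n + 1))) *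
          m.obsMass (x (n + 1)) (B (n + 1)))) := by
  have h := m.survival_mul_pathProb p₀ x B (Nat.lt_succ_self n)
  rw [pathProb_succ, prior, if_neg (by omega), Nat.add_sub_cancel,
    ENNReal.ofReal_mul (m.rho_nonneg _)]
  rw [show ∀ a b c d : ENNReal, a * b * (c * d) = (b * c) * (a * d) by intros; ring, h]
  rcases h : x n with s | s <;> simp [rho]

/-- A path that is post-change at `n + 1` either was so at `n`, with an earlier change time, or
changes exactly at `n + 1`; the latter supplies the `ρA_ν` transition. -/
lemma sum_prior_mul_pathProb (x : ℕ → State Nα Nβ) (B : ℕ → Set Y) (n : ℕ) :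
    ∑ k ∈ Finset.range (n + 1), ENNReal.ofReal (m.prior k x) * m.pathProb p₀ k n x B =
      if (x n).isLeft then 0 else m.pathWeight p₀ n x B := by
  induction n with
  | zero => rcases h : x 0 with s | s <;> simp [prior, pathWeight, h, init]
  | succ n ih =>
    -- The step into time `n + 1` is the same for all `k ≤ n`, so `k = 0` serves as representative
    -- and factors out of the sum.
    have hstep : ∀ k ∈ Finset.range (n + 1),
        ENNReal.ofReal (m.prior k x) * m.pathProb p₀ k (n + 1) x B =
          ENNReal.ofReal (m.prior k x) * m.pathProb p₀ k n x B *
            (ENNReal.ofReal (m.step 0 (n + 1) (x n) (x (n + 1))) *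
              m.obsMass (x (n + 1)) (B (n + 1))) := by
      intro k hk
      have hk := Finset.mem_range.1 hk
      rw [pathProb_succ, ← mul_assoc]
      congr 3
      rcases x n with s | s <;> rcases x (n + 1) with t | t
      · simp [step, hk.not_gt]
      · simp [step, hk.ne']
      · simp [step]
      · simp [step, hk]
    rw [Finset.sum_range_succ, Finset.sum_congr rfl hstep, ← Finset.sum_mul, ih,
      prior_succ_mul_pathProb, pathWeight_succ]
    rcases h : x n with s | s <;> rcases h' : x (n + 1) with t | t
    · simp [step]
    · simp [step, trans, rho, ENNReal.ofReal_mul (m.ρ_pos s).le, mul_assoc]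
    · simp [step, rho]
    · simp [step, trans, rho]

/-- Probability that the augmented chain, now in `s`, leaves the pre-change states in exactly
`j + 1` steps. -/
def hit (m : Model Nα Nβ lam) : ℕ → State Nα Nβ → ENNReal
  | 0 => fun s => ENNReal.ofReal (m.rho s)
  | j + 1 => fun s => ∑ t, m.trans s t * hit m j t

lemma hit_inr (j : ℕ) (s : Fin Nβ) : m.hit j (Sum.inr s) = 0 := by
  induction j generalizing s with
  | zero => simp [hit, rho]
  | succ j ih => simp [hit, trans, ih]

/-- Probability that the augmented chain, now in `s`, stays pre-change for `j` steps. -/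
def survival (m : Model Nα Nβ lam) : ℕ → Fin Nα → ENNReal
  | 0 => fun _ => 1
  | j + 1 => fun s => ∑ t, m.trans (Sum.inl s) (Sum.inl t) * survival m j t

lemma sum_trans_inl (s : Fin Nα) :
    ∑ t, m.trans (Sum.inl s) (Sum.inl t) = ENNReal.ofReal (1 - m.ρ s) := by
  have h : 0 ≤ 1 - m.ρ s := sub_nonneg.2 (m.ρ_lt_one s).le
  simp only [trans]
  rw [← ENNReal.ofReal_sum_of_nonneg fun t _ => mul_nonneg h (m.Aα_nonneg t s),
    ← Finset.mul_sum, m.Aα_sum, mul_one]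

/-- First-step analysis: the chain leaves the pre-change states at one of the next `j` steps or
survives all of them. -/
lemma sum_hit_add_survival (j : ℕ) (s : Fin Nα) :
    ∑ i ∈ Finset.range j, m.hit i (Sum.inl s) + m.survival j s = 1 := by
  induction j generalizing s with
  | zero => simp [survival]
  | succ j ih =>
    have h1 : ∀ i, m.hit (i + 1) (Sum.inl s) =
        ∑ t, m.trans (Sum.inl s) (Sum.inl t) * m.hit i (Sum.inl t) := by
      intro i
      simp [hit, Fintype.sum_sum_type, hit_inr]
    rw [Finset.sum_range_succ']
    simp only [h1]
    rw [Finset.sum_comm, survival, add_right_comm, ← Finset.sum_add_distrib]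
    simp only [← Finset.mul_sum, ← mul_add, ih, mul_one]
    have h0 : m.hit 0 (Sum.inl s) = ENNReal.ofReal (m.ρ s) := rfl
    rw [sum_trans_inl, h0,
      ← ENNReal.ofReal_add (sub_nonneg.2 (m.ρ_lt_one s).le) (m.ρ_pos s).le]
    simp

/-- With finitely many states the largest `1 - ρ s` is still below one and bounds each one-step
survival probability. -/
lemma exists_survival_le : ∃ r < 1, ∀ j s, m.survival j s ≤ r ^ j := by
  refine ⟨Finset.univ.sup fun s => ENNReal.ofReal (1 - m.ρ s), ?_, fun j => ?_⟩
  · refine (Finset.sup_lt_iff (by simp)).2 fun s _ => ?_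
    rw [ENNReal.ofReal_lt_one]
    linarith [m.ρ_pos s]
  · induction j with
    | zero => simp [survival]
    | succ j ih =>
      intro s
      calc m.survival (j + 1) s
          ≤ ∑ t, m.trans (Sum.inl s) (Sum.inl t) *
              (Finset.univ.sup fun s => ENNReal.ofReal (1 - m.ρ s)) ^ j :=
            Finset.sum_le_sum fun t _ => mul_le_mul_right (ih t) _
        _ ≤ _ := by
            rw [← Finset.sum_mul, sum_trans_inl, pow_succ, mul_comm]
            exact mul_le_mul_right
              (Finset.le_sup (f := fun s => ENNReal.ofReal (1 - m.ρ s)) (Finset.mem_univ s)) _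

/-- Survival decays geometrically, so the change occurs almost surely from every pre-change state.
-/
lemma tsum_hit (s : Fin Nα) : ∑' j, m.hit j (Sum.inl s) = 1 := by
  obtain ⟨r, hr, hs⟩ := m.exists_survival_le
  refine le_antisymm ?_ ?_
  · rw [ENNReal.tsum_eq_iSup_nat]
    exact iSup_le fun j => le_self_add.trans (m.sum_hit_add_survival j s).le
  · have hlim : Filter.Tendsto (fun j => ∑' j, m.hit j (Sum.inl s) + r ^ j) Filter.atTop
        (nhds (∑' j, m.hit j (Sum.inl s) + 0)) :=
      tendsto_const_nhds.add (ENNReal.tendsto_pow_atTop_nhds_zero_of_lt_one hr)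
    rw [add_zero] at hlim
    refine ge_of_tendsto' hlim fun j => ?_
    rw [← m.sum_hit_add_survival j s]
    exact add_le_add (ENNReal.sum_le_tsum _) (hs j s)

lemma sum_step_change (s : Fin Nα) (n : ℕ) :
    ∑ t, ENNReal.ofReal (m.step n n (Sum.inl s) t) = 1 := by
  simp only [Fintype.sum_sum_type, step, lt_irrefl, if_true, if_false, ENNReal.ofReal_zero,
    Finset.sum_const_zero, zero_add]
  rw [← ENNReal.ofReal_sum_of_nonneg fun t _ => m.Aν_nonneg t s, m.Aν_sum, ENNReal.ofReal_one]

end PathLaw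

end Model

/-! ### Law of the states and observations. -/

/-- The states up to time `n` follow the path `x` and the observations up to time `n` lie in the
sets `B`. -/
def pathEvent {Ω Y : Type*} (X : ℕ → Ω → State Nα Nβ) (y : ℕ → Ω → Y) (n : ℕ)
    (x : ℕ → State Nα Nβ) (B : ℕ → Set Y) : Set Ω :=
  {ω | (∀ l ≤ n, X l ω = x l) ∧ ∀ l ∈ Finset.Icc 1 n, y l ω ∈ B l}

lemma pathEvent_update {Ω Y : Type*} {X : ℕ → Ω → State Nα Nβ} {y : ℕ → Ω → Y} (n : ℕ) (x : ℕ → State Nα Nβ) (B : ℕ → Set Y) (t : State Nα Nβ)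
    (C : Set Y) :
    pathEvent X y (n + 1) (Function.update x (n + 1) t) (Function.update B (n + 1) C) =
      (pathEvent X y n x B ∩ y (n + 1) ⁻¹' C) ∩ {ω | X (n + 1) ω = t} := by
  ext ω
  simp only [pathEvent, Set.mem_ofPred_eq, Set.mem_inter_iff, Set.mem_preimage, Finset.mem_Icc]
  constructor
  · rintro ⟨h1, h2⟩
    refine ⟨⟨⟨fun l hl => ?_, fun l hl => ?_⟩, ?_⟩, ?_⟩
    · simpa [Function.update_of_ne (show l ≠ n + 1 by omega)] using h1 l (by omega)
    · simpa [Function.update_of_ne (show l ≠ n + 1 by omega)] using h2 l (by omega)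
    · simpa using h2 (n + 1) (by omega)
    · simpa using h1 (n + 1) le_rfl
  · rintro ⟨⟨⟨h1, h2⟩, h3⟩, h4⟩
    refine ⟨fun l hl => ?_, fun l hl => ?_⟩
    · rcases eq_or_ne l (n + 1) with rfl | hne
      · simpa using h4
      · simpa [Function.update_of_ne hne] using h1 l (by omega)
    · rcases eq_or_ne l (n + 1) with rfl | hne
      · simpa using h3
      · simpa [Function.update_of_ne hne] using h2 l (by omega)

/-- Extension of a finite path by its last value. -/
def extendPath (n : ℕ) (f : Fin (n + 1) → State Nα Nβ) (l : ℕ) : State Nα Nβ :=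
  f ⟨min l n, by omega⟩

lemma path_eq_iff {Ω : Type*} {X : ℕ → Ω → State Nα Nβ} (n : ℕ) (f : Fin (n + 1) → State Nα Nβ) (ω : Ω) :
    (fun l : Fin (n + 1) => X l ω) = f ↔ ∀ l ≤ n, X l ω = extendPath n f l := by
  constructor
  · rintro rfl l hl
    simp [extendPath, hl]
  · intro hf
    ext1 l
    have := hf l (by omega)
    rw [this, extendPath]
    congr
    omega

namespace IsProcess

variable {m : Model Nα Nβ lam} {p₀ : Fin Nα → ℝ} {Ω : Type*} [MeasurableSpace Ω] {P : Measure Ω}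
  {ν : Ω → ℕ} {X : ℕ → Ω → State Nα Nβ} {y : ℕ → Ω → Y}

lemma measurableSet_state (h : IsProcess m p₀ P ν X y) (k : ℕ) (s : State Nα Nβ) :
    MeasurableSet {ω | X k ω = s} := by
  have hs : MeasurableSet ({s} : Set (State Nα Nβ)) :=
    measurableSet_sum_iff.2 ⟨(Set.toFinite _).measurableSet, (Set.toFinite _).measurableSet⟩
  exact h.measurable_X k hs

lemma measurableSet_change (h : IsProcess m p₀ P ν X y) (k : ℕ) : MeasurableSet {ω | ν ω = k} :=
  h.measurable_ν (measurableSet_singleton k)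

lemma measurableSet_pathEvent (h : IsProcess m p₀ P ν X y) (n : ℕ) (x : ℕ → State Nα Nβ)
    {B : ℕ → Set Y} (hB : ∀ l, MeasurableSet (B l)) : MeasurableSet (pathEvent X y n x B) := by
  have heq : pathEvent X y n x B =
      (⋂ l, ⋂ (_ : l ≤ n), {ω | X l ω = x l}) ∩ ⋂ l ∈ Finset.Icc 1 n, y l ⁻¹' B l := by
    ext ω
    simp [pathEvent]
  rw [heq]
  exact (MeasurableSet.iInter fun l => MeasurableSet.iInter fun _ =>
    h.measurableSet_state l (x l)).inter
      (MeasurableSet.iInter fun l => MeasurableSet.iInter fun _ => h.measurable_y l (hB l))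

lemma measure_change_inter_pathEvent (h : IsProcess m p₀ P ν X y) {k n : ℕ} (hkn : k ≤ n)
    (x : ℕ → State Nα Nβ) {B : ℕ → Set Y} (hB : ∀ l, MeasurableSet (B l)) :
    P ({ω | ν ω = k} ∩ pathEvent X y n x B) =
      ENNReal.ofReal (m.prior k x) * m.pathProb p₀ k n x B :=
  h.law k n hkn x B hB

lemma measurableSet_update {B : ℕ → Set Y} (hB : ∀ l, MeasurableSet (B l)) (n : ℕ) {C : Set Y}
    (hC : MeasurableSet C) (l : ℕ) : MeasurableSet (Function.update B n C l) := by
  rcases eq_or_ne l n with rfl | hne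
  · simpa using hC
  · simpa [Function.update_of_ne hne] using hB l

lemma pathWeight_update (n : ℕ) (x : ℕ → State Nα Nβ) (B : ℕ → Set Y) (t : State Nα Nβ)
    (C : Set Y) :
    m.pathWeight p₀ (n + 1) (Function.update x (n + 1) t) (Function.update B (n + 1) C) =
      m.pathWeight p₀ n x B * (m.trans (x n) t * m.obsMass t C) := by
  rw [Model.pathWeight_succ, Function.update_self, Function.update_self,
    Function.update_of_ne (by omega)]
  congr 1
  exact m.pathWeight_congr p₀ (fun l hl => Function.update_of_ne (by omega) _ _)
    (fun l hl => Function.update_of_ne (by omega) _ _)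

/-- The defining law covers only horizons `n ≥ k`. A change after `n` is reached by summing over the
next states, with unrestricted observations, until the horizon meets the change time. -/
lemma measure_future_change_inter_pathEvent (h : IsProcess m p₀ P ν X y) (j n : ℕ)
    (x : ℕ → State Nα Nβ) {B : ℕ → Set Y} (hB : ∀ l, MeasurableSet (B l)) :
    P ({ω | ν ω = j + (n + 1)} ∩ pathEvent X y n x B) =
      m.pathWeight p₀ n x B * m.hit j (x n) := by
  have hsplit : ∀ k, P ({ω | ν ω = k} ∩ pathEvent X y n x B) =
      ∑ t, P ({ω | ν ω = k} ∩ pathEvent X y (n + 1) (Function.update x (n + 1) t)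
        (Function.update B (n + 1) Set.univ)) := by
    intro k
    rw [measure_eq_sum_fiber P (h.measurableSet_state (n + 1))]
    refine Finset.sum_congr rfl fun t _ => ?_
    rw [pathEvent_update, Set.preimage_univ, Set.inter_univ, Set.inter_assoc]
  have hB' := measurableSet_update hB (n + 1) MeasurableSet.univ
  rw [hsplit]
  induction j generalizing n x B with
  | zero =>
    rw [zero_add]
    have hterm : ∀ t, P ({ω | ν ω = n + 1} ∩ pathEvent X y (n + 1) (Function.update x (n + 1) t)
        (Function.update B (n + 1) Set.univ)) = m.pathWeight p₀ n x B *
          (ENNReal.ofReal (m.rho (x n)) * ENNReal.ofReal (m.step (n + 1) (n + 1) (x n) t)) := by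
      intro t
      rw [h.measure_change_inter_pathEvent le_rfl _ hB', Model.prior_succ_mul_pathProb,
        Function.update_self, Function.update_self, Function.update_of_ne (by omega),
        m.obsMass_univ, mul_one]
      congr 1
      exact m.pathWeight_congr p₀ (fun l hl => Function.update_of_ne (by omega) _ _)
        (fun l hl => Function.update_of_ne (by omega) _ _)
    simp only [hterm, ← Finset.mul_sum, Model.hit]
    rcases x n with s | s
    · rw [m.sum_step_change, mul_one]
    · simp [Model.rho]
  | succ j ih =>
    have hterm : ∀ t, P ({ω | ν ω = j + 1 + (n + 1)} ∩
        pathEvent X y (n + 1) (Function.update x (n + 1) t)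
          (Function.update B (n + 1) Set.univ)) =
        m.pathWeight p₀ n x B * (m.trans (x n) t * m.hit j t) := by
      intro t
      -- Seen from horizon `n + 1`, the change is one step closer, so the induction hypothesis
      -- applies there.
      rw [show j + 1 + (n + 1) = j + (n + 1 + 1) by omega]
      have hsplit' : ∀ k, P ({ω | ν ω = k} ∩ pathEvent X y (n + 1) (Function.update x (n + 1) t)
          (Function.update B (n + 1) Set.univ)) =
          ∑ u, P ({ω | ν ω = k} ∩ pathEvent X y (n + 1 + 1)
            (Function.update (Function.update x (n + 1) t) (n + 1 + 1) u)
            (Function.update (Function.update B (n + 1) Set.univ) (n + 1 + 1) Set.univ)) := by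
        intro k
        rw [measure_eq_sum_fiber P (h.measurableSet_state (n + 1 + 1))]
        refine Finset.sum_congr rfl fun u _ => ?_
        rw [pathEvent_update (n + 1), Set.preimage_univ, Set.inter_univ, Set.inter_assoc]
      rw [hsplit', ih (n + 1) _ hB' hsplit' (measurableSet_update hB' _ MeasurableSet.univ),
        pathWeight_update, Function.update_self, m.obsMass_univ, mul_one, mul_assoc]
    simp only [hterm, ← Finset.mul_sum, Model.hit]

lemma measure_eq_tsum_change (h : IsProcess m p₀ P ν X y) {A : Set Ω} (hA : MeasurableSet A) :
    P A = ∑' k, P ({ω | ν ω = k} ∩ A) := by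
  rw [← measure_iUnion]
  · congr 1
    ext ω
    simp
  · intro i j hij
    refine Set.disjoint_left.2 fun ω h1 h2 => hij ?_
    exact h1.1.symm.trans h2.1
  · exact fun k => (h.measurableSet_change k).inter hA

lemma sum_measure_past_change (h : IsProcess m p₀ P ν X y) (n : ℕ) (x : ℕ → State Nα Nβ)
    {B : ℕ → Set Y} (hB : ∀ l, MeasurableSet (B l)) :
    ∑ k ∈ Finset.range (n + 1), P ({ω | ν ω = k} ∩ pathEvent X y n x B) =
      if (x n).isLeft then 0 else m.pathWeight p₀ n x B := by
  rw [← m.sum_prior_mul_pathProb p₀ x B n]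
  refine Finset.sum_congr rfl fun k hk => h.measure_change_inter_pathEvent ?_ x hB
  exact Nat.lt_succ_iff.1 (Finset.mem_range.1 hk)

/-- The states and observations have the law of the augmented hidden Markov chain. -/
lemma measure_pathEvent (h : IsProcess m p₀ P ν X y) (n : ℕ) (x : ℕ → State Nα Nβ)
    {B : ℕ → Set Y} (hB : ∀ l, MeasurableSet (B l)) :
    P (pathEvent X y n x B) = m.pathWeight p₀ n x B := by
  have hsplit := Summable.sum_add_tsum_nat_add' (k := n + 1)
    (f := fun k => P ({ω | ν ω = k} ∩ pathEvent X y n x B)) ENNReal.summable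
  rw [h.measure_eq_tsum_change (h.measurableSet_pathEvent n x hB), ← hsplit,
    h.sum_measure_past_change n x hB]
  simp only [h.measure_future_change_inter_pathEvent _ n x hB, ENNReal.tsum_mul_left]
  -- A pre-change endpoint gets its mass only from future change times, whose `hit` weights sum to
  -- one; a post-change endpoint only from past ones.
  rcases x n with s | s
  · simp [m.tsum_hit]
  · simp [m.hit_inr]

lemma measurableSet_path (h : IsProcess m p₀ P ν X y) (n : ℕ) (f : Fin (n + 1) → State Nα Nβ) :
    MeasurableSet {ω | (fun l : Fin (n + 1) => X l ω) = f} := by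
  simp only [path_eq_iff, Set.ofPred_forall]
  exact MeasurableSet.iInter fun l => MeasurableSet.iInter fun _ => h.measurableSet_state l _

lemma measure_eq_zero_of_pathEvent (h : IsProcess m p₀ P ν X y) (n : ℕ) {A : Set Ω}
    (hA : ∀ x : ℕ → State Nα Nβ, P (A ∩ pathEvent X y n x fun _ => Set.univ) = 0) : P A = 0 := by
  rw [measure_eq_sum_fiber P (h.measurableSet_path n)]
  refine Finset.sum_eq_zero fun f _ => ?_
  refine (congrArg P ?_).trans (hA (extendPath n f))
  ext ω
  simp [pathEvent, path_eq_iff]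

/-- Almost surely, the change has happened by time `n` iff the state is a post-change state. -/
lemma ae_change_le_iff (h : IsProcess m p₀ P ν X y) (n : ℕ) :
    ∀ᵐ ω ∂P, ν ω ≤ n ↔ (X n ω).isRight := by
  rw [ae_iff]
  refine h.measure_eq_zero_of_pathEvent n fun x => ?_
  have hpast := h.sum_measure_past_change n x (B := fun _ => Set.univ) fun _ => MeasurableSet.univ
  have hfut := fun j => h.measure_future_change_inter_pathEvent j n x (B := fun _ => Set.univ)
    fun _ => MeasurableSet.univ
  -- Past change times carry no mass on paths ending pre-change, future ones none on paths ending
  -- post-change.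
  rcases hx : x n with s | s
  · rw [hx, Sum.isLeft_inl, if_pos rfl] at hpast
    refine measure_mono_null (t := ⋃ k ∈ Finset.range (n + 1),
      {ω | ν ω = k} ∩ pathEvent X y n x fun _ => Set.univ) ?_ ?_
    · rintro ω ⟨h1, h2⟩
      have h3 := h2.1 n le_rfl
      simp only [Set.mem_ofPred_eq, h3, hx, Sum.isRight_inl, Bool.false_eq_true, iff_false,
        not_not] at h1
      simp only [Set.mem_iUnion, Finset.mem_range]
      exact ⟨ν ω, by omega, rfl, h2⟩
    · exact (measure_biUnion_null_iff (Finset.countable_toSet _)).2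
        fun k hk => Finset.sum_eq_zero_iff.1 hpast k hk
  · refine measure_mono_null (t := ⋃ j,
      {ω | ν ω = j + (n + 1)} ∩ pathEvent X y n x fun _ => Set.univ) ?_ ?_
    · rintro ω ⟨h1, h2⟩
      have h3 := h2.1 n le_rfl
      simp only [Set.mem_ofPred_eq, h3, hx, Sum.isRight_inr, iff_true, not_le] at h1
      simp only [Set.mem_iUnion]
      exact ⟨ν ω - (n + 1), by simp only [Set.mem_ofPred_eq]; omega, h2⟩
    · rw [measure_iUnion_null_iff]
      intro j
      rw [hfut, hx, m.hit_inr, mul_zero]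

/-- The Markov property on observation cylinders: summed over full state paths, the extra factor
depends only on the last state. -/
lemma measure_obs_step (h : IsProcess m p₀ P ν X y) (k : ℕ) {B : ℕ → Set Y}
    (hB : ∀ l, MeasurableSet (B l)) {C : Set Y} (hC : MeasurableSet C) (t : State Nα Nβ) :
    P (({ω | ∀ l ∈ Finset.Icc 1 k, y l ω ∈ B l} ∩ y (k + 1) ⁻¹' C) ∩ {ω | X (k + 1) ω = t}) =
      ∑ s, m.trans s t * m.obsMass t C *
        P ({ω | ∀ l ∈ Finset.Icc 1 k, y l ω ∈ B l} ∩ {ω | X k ω = s}) := by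
  have hpath : ∀ f : Fin (k + 1) → State Nα Nβ,
      {ω | ∀ l ∈ Finset.Icc 1 k, y l ω ∈ B l} ∩ {ω | (fun l : Fin (k + 1) => X l ω) = f} =
        pathEvent X y k (extendPath k f) B := by
    intro f
    ext ω
    simp only [Set.mem_inter_iff, Set.mem_ofPred_eq, path_eq_iff, pathEvent]
    exact and_comm
  have hsum : ∀ s, P ({ω | ∀ l ∈ Finset.Icc 1 k, y l ω ∈ B l} ∩ {ω | X k ω = s}) =
      ∑ f : Fin (k + 1) → State Nα Nβ, if extendPath k f k = s then
        P (pathEvent X y k (extendPath k f) B) else 0 := by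
    intro s
    rw [measure_eq_sum_fiber P (h.measurableSet_path k)]
    refine Finset.sum_congr rfl fun f _ => ?_
    rw [Set.inter_right_comm, hpath]
    split_ifs with hs
    · congr 1
      exact Set.inter_eq_left.2 fun ω hω => (hω.1 k le_rfl).trans hs
    · convert measure_empty (μ := P)
      refine Set.eq_empty_of_forall_notMem fun ω hω => hs ?_
      exact (hω.1.1 k le_rfl).symm.trans hω.2
  simp only [hsum, Finset.mul_sum]
  rw [Finset.sum_comm, measure_eq_sum_fiber P (h.measurableSet_path k)]
  refine Finset.sum_congr rfl fun f _ => ?_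
  rw [Set.inter_right_comm, Set.inter_right_comm {ω | _}, hpath, ← pathEvent_update,
    h.measure_pathEvent _ _ (measurableSet_update hB _ hC), pathWeight_update,
    ← h.measure_pathEvent k _ hB, Finset.sum_eq_single (extendPath k f k), if_pos rfl, mul_comm]
  · intro s _ hs
    rw [if_neg (Ne.symm hs), mul_zero]
  · simp

end IsProcess

/-! ### The stopping region. -/

/-- A posterior vector with entries in `[0, ∞]`. -/
def toWeights (p : State Nα Nβ → ℝ) : State Nα Nβ → ENNReal := fun s => ENNReal.ofReal (p s)

lemma toWeights_ne_top (p : State Nα Nβ → ℝ) (s : State Nα Nβ) : toWeights p s ≠ ⊤ :=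
  ENNReal.ofReal_ne_top

lemma measurable_toWeights : Measurable (toWeights : (State Nα Nβ → ℝ) → _) := by
  unfold toWeights
  fun_prop

namespace Model

/-- The posteriors at which stopping at once is optimal. -/
def stopRegion (m : Model Nα Nβ lam) (c : ENNReal) : Set (State Nα Nβ → ℝ) :=
  {p | p ∈ stdSimplex ℝ (State Nα Nβ) ∧ m.value c (toWeights p) = preMass (toWeights p)}

lemma measurableSet_stopRegion [SFinite lam] (m : Model Nα Nβ lam) (c : ENNReal) :
    MeasurableSet (m.stopRegion c) :=
  (isClosed_stdSimplex ℝ (State Nα Nβ)).measurableSet.inter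
    (measurableSet_eq_fun ((m.measurable_value c).comp measurable_toWeights)
      (measurable_preMass.comp measurable_toWeights))

/-- At a convex combination, superadditivity and homogeneity bound the value below by the linear
`preMass`, which always bounds it above. -/
lemma convex_stopRegion [SFinite lam] (m : Model Nα Nβ lam) (c : ENNReal) :
    Convex ℝ (m.stopRegion c) := by
  rintro p ⟨hp, hp'⟩ q ⟨hq, hq'⟩ a b ha hb hab
  refine ⟨convex_stdSimplex ℝ _ hp hq ha hb hab, le_antisymm (m.value_le_preMass c _) ?_⟩
  have hcomb : toWeights (a • p + b • q) =
      ENNReal.ofReal a • toWeights p + ENNReal.ofReal b • toWeights q := by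
    ext s
    simp only [toWeights, Pi.add_apply, Pi.smul_apply, smul_eq_mul]
    rw [ENNReal.ofReal_add (mul_nonneg ha (hp.1 s)) (mul_nonneg hb (hq.1 s)),
      ENNReal.ofReal_mul ha, ENNReal.ofReal_mul hb]
  rw [hcomb, preMass_add, preMass_smul, preMass_smul, ← hp', ← hq',
    ← m.value_smul c ENNReal.ofReal_ne_top, ← m.value_smul c ENNReal.ofReal_ne_top]
  exact m.value_superadditive c _ _

lemma single_mem_stopRegion (m : Model Nα Nβ lam) (c : ENNReal) (i : Fin Nβ) :
    Pi.single (Sum.inr i) (1 : ℝ) ∈ m.stopRegion c := by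
  have h0 : preMass (toWeights (Pi.single (Sum.inr i) (1 : ℝ) : State Nα Nβ → ℝ)) = 0 := by
    simp [preMass, toWeights]
  refine ⟨single_mem_stdSimplex ℝ _, ?_⟩
  rw [h0]
  exact le_antisymm ((m.value_le_preMass c _).trans h0.le) zero_le

end Model

/-! ### Integrals of the posterior over observable events. -/

lemma obsFiltration_succ {Ω : Type*} [MeasurableSpace Ω] (y : ℕ → Ω → Y)
    (hy : ∀ k, Measurable (y k)) (k : ℕ) :
    obsFiltration y hy (k + 1) =
      @MeasurableSpace.comap Ω (Ω × Y) (fun ω => (ω, y (k + 1) ω))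
        ((obsFiltration y hy k).prod inferInstance) := by
  change (⨆ l ∈ Finset.Icc 1 (k + 1), MeasurableSpace.comap (y l) inferInstance) = _
  rw [MeasurableSpace.prod, MeasurableSpace.comap_sup, MeasurableSpace.comap_comp,
    MeasurableSpace.comap_comp]
  change _ = MeasurableSpace.comap id _ ⊔ MeasurableSpace.comap (y (k + 1)) _
  rw [MeasurableSpace.comap_id, ← Finset.insert_Icc_right_eq_Icc_add_one (by omega),
    Finset.iSup_insert, sup_comm]
  rfl

namespace IsPosterior

variable {Ω : Type*} [mΩ : MeasurableSpace Ω] {P : Measure Ω}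
  {𝒴 : Filtration ℕ mΩ} {X : ℕ → Ω → State Nα Nβ} {Zhat : ℕ → Ω → State Nα Nβ → ℝ}

lemma measurable (hZ : IsPosterior P 𝒴 X Zhat) (k : ℕ) : Measurable[𝒴 k] (Zhat k) :=
  @measurable_pi_lambda _ _ _ (𝒴 k) _ _ fun s => hZ.adapted k s

lemma ae_nonneg (hZ : IsPosterior P 𝒴 X Zhat) (k : ℕ) (s : State Nα Nβ) :
    ∀ᵐ ω ∂P, 0 ≤ Zhat k ω s := by
  have h : 0 ≤ᵐ[P] P[Set.indicator {ω | X k ω = s} (fun _ => (1 : ℝ)) | 𝒴 k] :=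
    condExp_nonneg (.of_forall fun ω => Set.indicator_nonneg (fun _ _ => zero_le_one) ω)
  filter_upwards [h, hZ.ae_eq k s] with ω h1 h2
  rw [h2]
  exact h1

lemma setLIntegral_toWeights [IsProbabilityMeasure P] (hZ : IsPosterior P 𝒴 X Zhat)
    (hX : ∀ k s, MeasurableSet {ω | X k ω = s}) (k : ℕ) {A : Set Ω} (hA : MeasurableSet[𝒴 k] A)
    (s : State Nα Nβ) :
    ∫⁻ ω in A, toWeights (Zhat k ω) s ∂P = P (A ∩ {ω | X k ω = s}) := by
  have hint : Integrable (Set.indicator {ω | X k ω = s} (fun _ => (1 : ℝ))) P :=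
    (integrable_const 1).indicator (hX k s)
  have hZint : Integrable (fun ω => Zhat k ω s) P := integrable_condExp.congr (hZ.ae_eq k s).symm
  simp only [toWeights]
  rw [← ofReal_integral_eq_lintegral_ofReal hZint.restrict
      (ae_restrict_of_ae (hZ.ae_nonneg k s)),
    integral_congr_ae (ae_restrict_of_ae (hZ.ae_eq k s)), setIntegral_condExp (𝒴.le k) hint hA,
    setIntegral_indicator (hX k s), setIntegral_const, smul_eq_mul, mul_one]
  exact ofReal_measureReal

/-- The state indicators sum to one, hence so do their conditional expectations; an arbitrary
version satisfies this only almost everywhere. -/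
lemma ae_mem_stdSimplex [IsProbabilityMeasure P] (hZ : IsPosterior P 𝒴 X Zhat)
    (hX : ∀ k s, MeasurableSet {ω | X k ω = s}) (k : ℕ) :
    ∀ᵐ ω ∂P, Zhat k ω ∈ stdSimplex ℝ (State Nα Nβ) := by
  classical
  have hint : ∀ s ∈ Finset.univ,
      Integrable (Set.indicator {ω | X k ω = s} (fun _ => (1 : ℝ))) P :=
    fun s _ => (integrable_const 1).indicator (hX k s)
  have hsum := condExp_finsetSum hint (𝒴 k)
  have hone : ∑ s, Set.indicator {ω | X k ω = s} (fun _ => (1 : ℝ)) = fun _ => 1 := by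
    ext ω
    simp [Set.indicator_apply]
  rw [hone, condExp_const (𝒴.le k)] at hsum
  filter_upwards [hsum, ae_all_iff.2 (hZ.ae_nonneg k), ae_all_iff.2 (hZ.ae_eq k)] with ω h1 h2 h3
  refine ⟨h2, ?_⟩
  rw [Finset.sum_apply] at h1
  simp only [h3]
  exact h1.symm

lemma setLIntegral_sum_toWeights [IsProbabilityMeasure P] (hZ : IsPosterior P 𝒴 X Zhat)
    (hX : ∀ k s, MeasurableSet {ω | X k ω = s}) (k : ℕ) {A : Set Ω} (hA : MeasurableSet[𝒴 k] A)
    {ι : Type*} [Fintype ι] {f : ι → State Nα Nβ} (hf : Function.Injective f) :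
    ∫⁻ ω in A, ∑ i, toWeights (Zhat k ω) (f i) ∂P = P (A ∩ {ω | X k ω ∈ Set.range f}) := by
  have hm : Measurable (Zhat k) := (hZ.measurable k).mono (𝒴.le k) le_rfl
  have hms : ∀ s, Measurable fun ω => toWeights (Zhat k ω) s :=
    fun s => (measurable_pi_apply s).comp (measurable_toWeights.comp hm)
  have hunion : A ∩ {ω | X k ω ∈ Set.range f} = ⋃ i, A ∩ {ω | X k ω = f i} := by
    ext ω
    simp [eq_comm]
  rw [lintegral_finsetSum _ fun i _ => hms (f i), hunion, measure_iUnion, tsum_fintype]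
  · simp only [hZ.setLIntegral_toWeights hX k hA]
  · intro i j hij
    refine Set.disjoint_left.2 fun ω h1 h2 => hij (hf ?_)
    exact h1.2.symm.trans h2.2
  · exact fun i => (𝒴.le k _ hA).inter (hX k _)

lemma setLIntegral_preMass [IsProbabilityMeasure P] (hZ : IsPosterior P 𝒴 X Zhat)
    (hX : ∀ k s, MeasurableSet {ω | X k ω = s}) (k : ℕ) {A : Set Ω} (hA : MeasurableSet[𝒴 k] A) :
    ∫⁻ ω in A, preMass (toWeights (Zhat k ω)) ∂P = P (A ∩ {ω | (X k ω).isLeft}) := by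
  refine (hZ.setLIntegral_sum_toWeights hX k hA Sum.inl_injective).trans ?_
  congr 2
  ext ω
  cases hω : X k ω <;> simp [hω]

lemma setLIntegral_postMass [IsProbabilityMeasure P] (hZ : IsPosterior P 𝒴 X Zhat)
    (hX : ∀ k s, MeasurableSet {ω | X k ω = s}) (k : ℕ) {A : Set Ω} (hA : MeasurableSet[𝒴 k] A) :
    ∫⁻ ω in A, postMass (toWeights (Zhat k ω)) ∂P = P (A ∩ {ω | (X k ω).isRight}) := by
  refine (hZ.setLIntegral_sum_toWeights hX k hA Sum.inr_injective).trans ?_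
  congr 2
  ext ω
  cases hω : X k ω <;> simp [hω]

end IsPosterior

/-! ### Markov property relative to the observation filtration. -/

namespace IsProcess

variable {m : Model Nα Nβ lam} {p₀ : Fin Nα → ℝ} {Ω : Type*} [mΩ : MeasurableSpace Ω]
  {P : Measure Ω} [IsProbabilityMeasure P] {ν : Ω → ℕ} {X : ℕ → Ω → State Nα Nβ} {y : ℕ → Ω → Y}
  {Zhat : ℕ → Ω → State Nα Nβ → ℝ}

/-- Markov property of the augmented chain with respect to the observation filtration. -/
lemma measure_step (h : IsProcess m p₀ P ν X y) (k : ℕ) {A : Set Ω}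
    (hA : MeasurableSet[obsFiltration y h.measurable_y k] A) {C : Set Y} (hC : MeasurableSet C)
    (t : State Nα Nβ) :
    P ((A ∩ y (k + 1) ⁻¹' C) ∩ {ω | X (k + 1) ω = t}) =
      ∑ s, m.trans s t * m.obsMass t C * P (A ∩ {ω | X k ω = s}) := by
  have hle := (obsFiltration y h.measurable_y).le k
  -- Both sides, as functions of `A`, are measures on `𝒴_k`; it suffices to compare them on the
  -- π-system of observation cylinders.
  let μ₁ := (P.restrict (y (k + 1) ⁻¹' C ∩ {ω | X (k + 1) ω = t})).trim hle
  let μ₂ := ∑ s, (m.trans s t * m.obsMass t C) • (P.restrict {ω | X k ω = s}).trim hle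
  have h₁ : ∀ A, MeasurableSet[obsFiltration y h.measurable_y k] A →
      μ₁ A = P ((A ∩ y (k + 1) ⁻¹' C) ∩ {ω | X (k + 1) ω = t}) := by
    intro A hA
    rw [trim_measurableSet_eq hle hA, Measure.restrict_apply (hle _ hA), Set.inter_assoc]
  have h₂ : ∀ A, MeasurableSet[obsFiltration y h.measurable_y k] A →
      μ₂ A = ∑ s, m.trans s t * m.obsMass t C * P (A ∩ {ω | X k ω = s}) := by
    intro A hA
    simp only [μ₂, Measure.coe_finsetSum, Finset.sum_apply, Measure.smul_apply, smul_eq_mul,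
      trim_measurableSet_eq hle hA, Measure.restrict_apply (hle _ hA)]
  have hgen : (obsFiltration y h.measurable_y k : MeasurableSpace Ω) =
      MeasurableSpace.generateFrom (piiUnionInter
        (fun l => {s | MeasurableSet[MeasurableSpace.comap (y l) inferInstance] s})
        (Finset.Icc 1 k : Set ℕ)) := by
    refine Eq.trans ?_ (generateFrom_piiUnionInter_measurableSet
      (fun l => MeasurableSpace.comap (y l) inferInstance) _).symm
    rfl
  have hcyl : ∀ B : ℕ → Set Y, (∀ l, MeasurableSet (B l)) →
      MeasurableSet[obsFiltration y h.measurable_y k]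
        {ω | ∀ l ∈ Finset.Icc 1 k, y l ω ∈ B l} := by
    intro B hB
    have heq : {ω | ∀ l ∈ Finset.Icc 1 k, y l ω ∈ B l} =
        ⋂ l ∈ Finset.Icc 1 k, y l ⁻¹' B l := by
      ext ω
      simp
    rw [heq]
    refine Finset.measurableSet_biInter _ fun l hl => ?_
    exact le_biSup (fun l => MeasurableSpace.comap (y l) inferInstance) hl _ ⟨B l, hB l, rfl⟩
  have hmain : ∀ B : ℕ → Set Y, (∀ l, MeasurableSet (B l)) →
      μ₁ {ω | ∀ l ∈ Finset.Icc 1 k, y l ω ∈ B l} =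
        μ₂ {ω | ∀ l ∈ Finset.Icc 1 k, y l ω ∈ B l} := by
    intro B hB
    rw [h₁ _ (hcyl B hB), h₂ _ (hcyl B hB), h.measure_obs_step k hB hC t]
  have hμ : μ₁ = μ₂ := by
    have : IsFiniteMeasure μ₁ := isFiniteMeasure_trim hle
    refine ext_of_generate_finite _ hgen
      (isPiSystem_piiUnionInter _ (fun l =>
        @MeasurableSpace.isPiSystem_measurableSet Ω (MeasurableSpace.comap (y l) inferInstance)) _) ?_ ?_
    · rintro _ ⟨T, hT, f, hf, rfl⟩
      classical
      choose! g hg using hf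
      have heq : ⋂ l ∈ T, f l =
          {ω | ∀ l ∈ Finset.Icc 1 k, y l ω ∈ if l ∈ T then g l else Set.univ} := by
        ext ω
        simp only [Set.mem_iInter, Set.mem_ofPred_eq]
        constructor
        · intro hω l _
          split_ifs with hl
          · have := hω l hl
            rwa [← (hg l hl).2] at this
          · trivial
        · intro hω l hl
          have := hω l (hT hl)
          rw [if_pos hl] at this
          rwa [← (hg l hl).2]
      rw [heq]
      refine hmain _ fun l => ?_
      split_ifs with hl
      · exact (hg l hl).1
      · exact MeasurableSet.univ
    · have := hmain (fun _ => Set.univ) fun _ => MeasurableSet.univ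
      simpa using this
  rw [← h₁ A hA, hμ, h₂ A hA]

/-- Expected optimal cost after one more observation. -/
lemma setLIntegral_value_succ [SigmaFinite lam] (h : IsProcess m p₀ P ν X y)
    (hZ : IsPosterior P (obsFiltration y h.measurable_y) X Zhat) (c : ENNReal) (k : ℕ) {A : Set Ω}
    (hA : MeasurableSet[obsFiltration y h.measurable_y k] A) :
    ∫⁻ ω in A, m.value c (toWeights (Zhat (k + 1) ω)) ∂P =
      ∫⁻ ω in A, ∫⁻ y, m.value c (m.update (toWeights (Zhat k ω)) y) ∂lam ∂P := by
  have hX := h.measurableSet_state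
  have hle := (obsFiltration y h.measurable_y).le k
  have hz : Measurable[obsFiltration y h.measurable_y k] fun ω => toWeights (Zhat k ω) :=
    measurable_toWeights.comp (hZ.measurable k)
  -- The past is `Ω` itself carrying the σ-algebra `𝒴_k`, with `π` the identity.
  have hstep : @Model.IsFilterStep Nα Nβ Y _ lam Ω Ω _ (obsFiltration y h.measurable_y k) m P id
      (y (k + 1)) (X (k + 1)) (fun ω => toWeights (Zhat k ω)) :=
    @Model.IsFilterStep.mk Nα Nβ Y _ lam Ω Ω _ (obsFiltration y h.measurable_y k) m P id
      (y (k + 1)) (X (k + 1)) (fun ω => toWeights (Zhat k ω)) (measurable_id'' hle)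
      (h.measurable_y _) (hX _) hz (fun _ _ => toWeights_ne_top _ _) (by
        intro A hA B hB t
        have hzs : ∀ s, Measurable fun ω => toWeights (Zhat k ω) s := fun s =>
          (measurable_pi_apply s).comp (hz.mono hle le_rfl)
        rw [Set.preimage_id, h.measure_step k hA hB t]
        simp only [id]
        rw [lintegral_finsetSum _ fun s _ => (hzs s).const_mul _, Finset.sum_mul]
        refine Finset.sum_congr rfl fun s _ => ?_
        rw [lintegral_const_mul _ (hzs s), hZ.setLIntegral_toWeights hX k hA, Model.obsMass]
        ring)
  have hsucc := obsFiltration_succ y h.measurable_y k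
  refine @Model.IsFilterStep.setLIntegral_value Nα Nβ Y _ lam Ω Ω _
    (obsFiltration y h.measurable_y k) m P id (y (k + 1)) (X (k + 1))
    (fun ω => toWeights (Zhat k ω)) _ _ hstep c (fun ω => toWeights (Zhat (k + 1) ω)) ?_ ?_ A hA
  · intro t
    have : Measurable[obsFiltration y h.measurable_y (k + 1)]
        fun ω => toWeights (Zhat (k + 1) ω) t :=
      (measurable_pi_apply t).comp (measurable_toWeights.comp (hZ.measurable (k + 1)))
    rw [hsucc] at this
    exact this
  · intro t C hC
    refine hZ.setLIntegral_toWeights hX (k + 1) ?_ t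
    rw [hsucc]
    exact ⟨C, hC, rfl⟩

end IsProcess

/-! ### Counting the delay, and entry times. -/

lemma toENNReal_sub_eq_tsum (a : ℕ∞) (n : ℕ) :
    ((a - n : ℕ∞) : ENNReal) =
      ∑' k : ℕ, {k : ℕ | n ≤ k ∧ (k : ℕ∞) < a}.indicator (1 : ℕ → ENNReal) k := by
  rw [← tsum_subtype]
  simp only [Pi.one_apply, ENNReal.tsum_set_one]
  congr 1
  induction a using ENat.recTopCoe with
  | top =>
    have : {k : ℕ | n ≤ k ∧ (k : ℕ∞) < ⊤} = Set.Ici n := by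
      ext k
      simp
    rw [this, (Set.Ici_infinite n).encard_eq]
    simp
  | coe a =>
    have : {k : ℕ | n ≤ k ∧ (k : ℕ∞) < a} = (Finset.Ico n a : Finset ℕ) := by
      ext k
      simp
    rw [this, Set.encard_coe_eq_coe_finsetCard, Nat.card_Ico, ENat.natCast_sub]

lemma setLIntegral_le_split {Ω : Type*} [MeasurableSpace Ω] {P : Measure Ω} {τ : Ω → ℕ∞} {n : ℕ}
    (hlt : MeasurableSet {ω | (n : ℕ∞) < τ ω})
    (f : Ω → ENNReal) :
    ∫⁻ ω in {ω | (n : ℕ∞) ≤ τ ω}, f ω ∂P =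
      ∫⁻ ω in {ω | τ ω = n}, f ω ∂P + ∫⁻ ω in {ω | (n : ℕ∞) < τ ω}, f ω ∂P := by
  rw [← lintegral_union hlt]
  · congr 2
    ext ω
    simp [le_iff_eq_or_lt, eq_comm]
  · exact Set.disjoint_left.2 fun ω h1 h2 => (lt_irrefl (n : ℕ∞)) (h1 ▸ h2)

lemma setOf_succ_le {Ω : Type*} {τ : Ω → ℕ∞} (n : ℕ) :
    {ω | ((n + 1 : ℕ) : ℕ∞) ≤ τ ω} = {ω | (n : ℕ∞) < τ ω} := by
  ext ω
  simp only [Set.mem_ofPred_eq, Nat.cast_add, Nat.cast_one]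
  exact ENat.add_one_le_iff (ENat.natCast_ne_top n)

lemma entryTime_le_iff {Ω E : Type*} (Zhat : ℕ → Ω → E) (R : Set E) (ω : Ω) (k : ℕ) :
    entryTime Zhat R ω ≤ k ↔ ∃ j ≤ k, Zhat j ω ∈ R := by
  constructor
  · intro hle
    by_contra! hR
    have : ((k + 1 : ℕ) : ℕ∞) ≤ entryTime Zhat R ω :=
      le_iInf₂ fun j hj => Nat.cast_le.2 (Nat.lt_of_not_ge fun hjk => hR j hjk hj)
    exact absurd (Nat.cast_le.1 (this.trans hle)) (by omega)
  · rintro ⟨j, hjk, hj⟩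
    exact (iInf₂_le j hj).trans (Nat.cast_le.2 hjk)

lemma mem_of_entryTime_eq {Ω E : Type*} {Zhat : ℕ → Ω → E} {R : Set E} {ω : Ω} {k : ℕ}
    (h : entryTime Zhat R ω = k) : Zhat k ω ∈ R := by
  obtain ⟨j, hjk, hj⟩ := (entryTime_le_iff Zhat R ω k).1 h.le
  have : (k : ℕ∞) ≤ j := h ▸ (entryTime_le_iff Zhat R ω j).2 ⟨j, le_rfl, hj⟩
  rwa [le_antisymm (Nat.cast_le.1 this) hjk]

lemma notMem_of_lt_entryTime {Ω E : Type*} {Zhat : ℕ → Ω → E} {R : Set E} {ω : Ω} {k : ℕ}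
    (h : (k : ℕ∞) < entryTime Zhat R ω) : Zhat k ω ∉ R :=
  fun hk => h.not_ge ((entryTime_le_iff Zhat R ω k).2 ⟨k, le_rfl, hk⟩)

lemma isStoppingTime_entryTime {Ω E : Type*} [mΩ : MeasurableSpace Ω] [MeasurableSpace E]
    {𝒴 : Filtration ℕ mΩ} {Zhat : ℕ → Ω → E} (hZ : ∀ k, Measurable[𝒴 k] (Zhat k)) {R : Set E}
    (hR : MeasurableSet R) : IsStoppingTime 𝒴 (entryTime Zhat R) := by
  intro k
  have : {ω | entryTime Zhat R ω ≤ k} = ⋃ j, ⋃ (_ : j ≤ k), Zhat j ⁻¹' R := by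
    ext ω
    simp [entryTime_le_iff]
  exact this ▸ MeasurableSet.iUnion fun j => MeasurableSet.iUnion fun hj =>
    𝒴.mono hj _ (hZ j hR)

/-! ### Cost decomposition and verification. -/

namespace IsProcess

variable {m : Model Nα Nβ lam} {p₀ : Fin Nα → ℝ} {Ω : Type*} [mΩ : MeasurableSpace Ω]
  {P : Measure Ω} {ν : Ω → ℕ} {X : ℕ → Ω → State Nα Nβ} {y : ℕ → Ω → Y}
  {Zhat : ℕ → Ω → State Nα Nβ → ℝ}

/-- The part of the cost of `τ` that is incurred at time `k`. -/
def costAt (P : Measure Ω) (X : ℕ → Ω → State Nα Nβ) (c : ENNReal) (τ : Ω → ℕ∞) (k : ℕ) :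
    ENNReal :=
  c * P ({ω | (k : ℕ∞) < τ ω} ∩ {ω | (X k ω).isRight}) +
    P ({ω | τ ω = k} ∩ {ω | (X k ω).isLeft})

/-- The delay counts the times `ν ≤ k < τ`, and a false alarm has `τ = k < ν` for one `k`, as `ν` is
finite. Almost surely the regime of `X k` decides between `ν ≤ k` and `k < ν`. -/
lemma cost_eq_tsum (h : IsProcess m p₀ P ν X y) (c : ℝ) {τ : Ω → ℕ∞}
    (hlt : ∀ k : ℕ, MeasurableSet {ω | (k : ℕ∞) < τ ω})
    (heq : ∀ k : ℕ, MeasurableSet {ω | τ ω = k}) :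
    cost P c ν τ = ∑' k, costAt P X (ENNReal.ofReal c) τ k := by
  have hle : ∀ k, MeasurableSet {ω | ν ω ≤ k} := fun k => h.measurable_ν measurableSet_Iic
  have hgt : ∀ k, MeasurableSet {ω | k < ν ω} := fun k => h.measurable_ν measurableSet_Ioi
  have hdelay : ∫⁻ ω, ((τ ω - (ν ω : ℕ∞) : ℕ∞) : ENNReal) ∂P =
      ∑' k : ℕ, P ({ω | (k : ℕ∞) < τ ω} ∩ {ω | (X k ω).isRight}) := by
    have hind : ∀ ω, ((τ ω - (ν ω : ℕ∞) : ℕ∞) : ENNReal) =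
        ∑' k : ℕ, ({ω | (k : ℕ∞) < τ ω} ∩ {ω | ν ω ≤ k}).indicator (1 : Ω → ENNReal) ω := by
      intro ω
      rw [toENNReal_sub_eq_tsum]
      refine tsum_congr fun k => ?_
      simp [Set.indicator_apply, and_comm]
    simp only [hind]
    rw [lintegral_tsum fun k =>
      (measurable_one.indicator ((hlt k).inter (hle k))).aemeasurable]
    refine tsum_congr fun k => ?_
    rw [lintegral_indicator_one ((hlt k).inter (hle k))]
    refine measure_congr ?_
    filter_upwards [h.ae_change_le_iff k] with ω hω
    exact propext (and_congr_right fun _ => hω)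
  have halarm : P {ω | τ ω < (ν ω : ℕ∞)} =
      ∑' k : ℕ, P ({ω | τ ω = k} ∩ {ω | (X k ω).isLeft}) := by
    have hunion : {ω | τ ω < (ν ω : ℕ∞)} = ⋃ k : ℕ, {ω | τ ω = k} ∩ {ω | k < ν ω} := by
      ext ω
      simp only [Set.mem_ofPred_eq, Set.mem_iUnion, Set.mem_inter_iff]
      constructor
      · intro hω
        obtain ⟨k, hk⟩ := ENat.ne_top_iff_exists.1 hω.ne_top
        exact ⟨k, hk.symm, by rwa [← hk, Nat.cast_lt] at hω⟩
      · rintro ⟨k, hk, hkν⟩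
        rwa [hk, Nat.cast_lt]
    rw [hunion, measure_iUnion]
    · refine tsum_congr fun k => measure_congr ?_
      filter_upwards [h.ae_change_le_iff k] with ω hω
      refine propext (and_congr_right fun _ => ?_)
      change k < ν ω ↔ (X k ω).isLeft = true
      rw [← not_le, hω]
      simp
    · intro i j hij
      refine Set.disjoint_left.2 fun ω h1 h2 => hij ?_
      exact Nat.cast_injective (h1.1.symm.trans h2.1)
    · exact fun k => (heq k).inter (hgt k)
  simp only [costAt]
  rw [cost, hdelay, halarm, ENNReal.tsum_add, ENNReal.tsum_mul_left]

section DynamicProgramming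

variable [IsProbabilityMeasure P] [SigmaFinite lam]

lemma setLIntegral_contCost (h : IsProcess m p₀ P ν X y)
    (hZ : IsPosterior P (obsFiltration y h.measurable_y) X Zhat) (c : ENNReal) (k : ℕ) {A : Set Ω}
    (hA : MeasurableSet[obsFiltration y h.measurable_y k] A) :
    ∫⁻ ω in A, m.contCost c (m.value c) (toWeights (Zhat k ω)) ∂P =
      c * P (A ∩ {ω | (X k ω).isRight}) +
        ∫⁻ ω in A, m.value c (toWeights (Zhat (k + 1) ω)) ∂P := by
  have hm : Measurable fun ω => postMass (toWeights (Zhat k ω)) :=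
    measurable_postMass.comp (measurable_toWeights.comp
      ((hZ.measurable k).mono ((obsFiltration y h.measurable_y).le k) le_rfl))
  simp only [Model.contCost]
  rw [lintegral_add_left (hm.const_mul c), lintegral_const_mul c hm,
    hZ.setLIntegral_postMass h.measurableSet_state k hA, h.setLIntegral_value_succ hZ c k hA]

/-- One Bellman inequality per step: the value is bounded by the stopping cost on `{τ = n}` and by
the continuation cost on `{n < τ}`. -/
lemma lintegral_value_le_sum_costAt (h : IsProcess m p₀ P ν X y)
    (hZ : IsPosterior P (obsFiltration y h.measurable_y) X Zhat) (c : ENNReal) {τ : Ω → ℕ∞}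
    (hτ : IsStoppingTime (obsFiltration y h.measurable_y) τ) (n : ℕ) :
    ∫⁻ ω, m.value c (toWeights (Zhat 0 ω)) ∂P ≤
      ∑ k ∈ Finset.range n, costAt P X c τ k +
        ∫⁻ ω in {ω | (n : ℕ∞) ≤ τ ω}, m.value c (toWeights (Zhat n ω)) ∂P := by
  induction n with
  | zero => simp
  | succ n ih =>
    refine ih.trans ?_
    have hle := (obsFiltration y h.measurable_y).le n
    have hlt : MeasurableSet[obsFiltration y h.measurable_y n] {ω | (n : ℕ∞) < τ ω} :=
      hτ.measurableSet_gt n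
    have heq : MeasurableSet[obsFiltration y h.measurable_y n] {ω | τ ω = (n : ℕ∞)} :=
      hτ.measurableSet_eq n
    rw [Finset.sum_range_succ, add_assoc, setLIntegral_le_split (hle _ hlt), setOf_succ_le]
    refine add_le_add le_rfl ?_
    rw [costAt, add_right_comm, add_comm, ← h.setLIntegral_contCost hZ c n hlt,
      ← hZ.setLIntegral_preMass h.measurableSet_state n heq]
    refine add_le_add (lintegral_mono fun ω => ?_) (lintegral_mono fun ω => m.value_le_preMass c _)
    rw [m.value_eq_min c (toWeights_ne_top _)]
    exact min_le_right _ _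

/-- The entry time attains the Bellman minimum at every step, so the preceding inequality becomes an
equality. -/
lemma sum_costAt_entryTime_add (h : IsProcess m p₀ P ν X y)
    (hZ : IsPosterior P (obsFiltration y h.measurable_y) X Zhat) (c : ENNReal) (n : ℕ) :
    ∑ k ∈ Finset.range n, costAt P X c (entryTime Zhat (m.stopRegion c)) k +
        ∫⁻ ω in {ω | (n : ℕ∞) ≤ entryTime Zhat (m.stopRegion c) ω},
          m.value c (toWeights (Zhat n ω)) ∂P =
      ∫⁻ ω, m.value c (toWeights (Zhat 0 ω)) ∂P := by
  have hτ := isStoppingTime_entryTime hZ.measurable (m.measurableSet_stopRegion c)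
  induction n with
  | zero => simp
  | succ n ih =>
    rw [← ih]
    have hle := (obsFiltration y h.measurable_y).le n
    have hlt : MeasurableSet[obsFiltration y h.measurable_y n]
        {ω | (n : ℕ∞) < entryTime Zhat (m.stopRegion c) ω} := hτ.measurableSet_gt n
    have heq : MeasurableSet[obsFiltration y h.measurable_y n]
        {ω | entryTime Zhat (m.stopRegion c) ω = (n : ℕ∞)} := hτ.measurableSet_eq n
    rw [Finset.sum_range_succ, add_assoc, setLIntegral_le_split (hle _ hlt), setOf_succ_le]
    congr 1
    rw [costAt, add_right_comm, add_comm, ← h.setLIntegral_contCost hZ c n hlt,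
      ← hZ.setLIntegral_preMass h.measurableSet_state n heq]
    congr 1
    · exact setLIntegral_congr_fun (hle _ heq) fun ω hω => (mem_of_entryTime_eq hω).2.symm
    -- Before entry the posterior is almost surely in the simplex but outside the region, so the
    -- value differs from `preMass` and must be the continuation cost.
    · refine setLIntegral_congr_fun_ae (hle _ hlt) ?_
      filter_upwards [hZ.ae_mem_stdSimplex h.measurableSet_state n] with ω hω hn
      have hne : m.value c (toWeights (Zhat n ω)) ≠ preMass (toWeights (Zhat n ω)) :=
        fun hv => notMem_of_lt_entryTime hn ⟨hω, hv⟩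
      have hmin := m.value_eq_min c (toWeights_ne_top (Zhat n ω))
      rcases min_choice (preMass (toWeights (Zhat n ω)))
        (m.contCost c (m.value c) (toWeights (Zhat n ω))) with h1 | h1
      · exact absurd (hmin.trans h1) hne
      · exact (hmin.trans h1).symm

/-- The value is at most `preMass`, whose integral is at most `P(n < ν)`; these events decrease to
the empty set. -/
lemma tendsto_setLIntegral_value (h : IsProcess m p₀ P ν X y)
    (hZ : IsPosterior P (obsFiltration y h.measurable_y) X Zhat) (c : ENNReal) (A : ℕ → Set Ω)
    (hA : ∀ n, MeasurableSet[obsFiltration y h.measurable_y n] (A n)) :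
    Filter.Tendsto (fun n => ∫⁻ ω in A n, m.value c (toWeights (Zhat n ω)) ∂P) Filter.atTop
      (nhds 0) := by
  have hgt : ∀ n, MeasurableSet {ω | n < ν ω} := fun k => h.measurable_ν measurableSet_Ioi
  have hlim : Filter.Tendsto (fun n => P {ω | n < ν ω}) Filter.atTop (nhds 0) := by
    have hanti : Antitone fun n => {ω | n < ν ω} := fun i j hij ω hω => lt_of_le_of_lt hij hω
    have := tendsto_measure_iInter_atTop (μ := P) (fun n => (hgt n).nullMeasurableSet) hanti
      ⟨0, measure_ne_top P _⟩
    have hempty : ⋂ n, {ω | n < ν ω} = ∅ := by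
      refine Set.eq_empty_of_forall_notMem fun ω hω => ?_
      exact lt_irrefl (ν ω) (Set.mem_iInter.1 hω (ν ω))
    rwa [hempty, measure_empty] at this
  refine tendsto_of_tendsto_of_tendsto_of_le_of_le tendsto_const_nhds hlim (fun _ => zero_le) ?_
  intro n
  calc ∫⁻ ω in A n, m.value c (toWeights (Zhat n ω)) ∂P
      ≤ ∫⁻ ω in A n, preMass (toWeights (Zhat n ω)) ∂P :=
        lintegral_mono fun ω => m.value_le_preMass c _
    _ = P (A n ∩ {ω | (X n ω).isLeft}) := hZ.setLIntegral_preMass h.measurableSet_state n (hA n)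
    _ ≤ P {ω | n < ν ω} := by
        refine measure_mono_ae ?_
        filter_upwards [h.ae_change_le_iff n] with ω hω hmem
        have hleft : (X n ω).isLeft = true := hmem.2
        refine not_le.1 fun hle => ?_
        have hright := hω.1 hle
        rw [← Sum.not_isLeft, hleft] at hright
        exact hright rfl

/-- Optimality of the first entry time of the posterior into the stopping region. -/
theorem cost_entryTime_le (h : IsProcess m p₀ P ν X y)
    (hZ : IsPosterior P (obsFiltration y h.measurable_y) X Zhat) (c : ℝ) {τ : Ω → ℕ∞}
    (hτ : IsStoppingTime (obsFiltration y h.measurable_y) τ) :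
    cost P c ν (entryTime Zhat (m.stopRegion (ENNReal.ofReal c))) ≤ cost P c ν τ := by
  have hle := (obsFiltration y h.measurable_y).le
  have hσ := isStoppingTime_entryTime hZ.measurable (m.measurableSet_stopRegion (ENNReal.ofReal c))
  rw [h.cost_eq_tsum c (fun k => hle k _ (hσ.measurableSet_gt k))
      (fun k => hle k _ (hσ.measurableSet_eq k)),
    h.cost_eq_tsum c (fun k => hle k _ (hτ.measurableSet_gt k))
      (fun k => hle k _ (hτ.measurableSet_eq k))]
  calc ∑' k, costAt P X (ENNReal.ofReal c) (entryTime Zhat (m.stopRegion (ENNReal.ofReal c))) k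
      ≤ ∫⁻ ω, m.value (ENNReal.ofReal c) (toWeights (Zhat 0 ω)) ∂P := by
        -- For this bound the nonnegative remainder is simply dropped; only the bound for a general
        -- `τ` needs it to vanish.
        rw [ENNReal.tsum_eq_iSup_nat]
        exact iSup_le fun n =>
          le_self_add.trans (h.sum_costAt_entryTime_add hZ (ENNReal.ofReal c) n).le
    _ ≤ ∑' k, costAt P X (ENNReal.ofReal c) τ k := by
        have hlim := h.tendsto_setLIntegral_value hZ (ENNReal.ofReal c)
          (fun n => {ω | (n : ℕ∞) ≤ τ ω}) fun n => hτ.measurableSet_ge n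
        have hlim' := (tendsto_const_nhds
          (x := ∑' k, costAt P X (ENNReal.ofReal c) τ k)).add hlim
        rw [add_zero] at hlim'
        exact ge_of_tendsto' hlim' fun n =>
          (h.lintegral_value_le_sum_costAt hZ (ENNReal.ofReal c) hτ n).trans
            (add_le_add (ENNReal.sum_le_tsum _) le_rfl)

end DynamicProgramming

end IsProcess

end HMMQCD

end

theorem theorem1 {Nα Nβ : ℕ} {Y : Type*} [MeasurableSpace Y] (lam : Measure Y) [SigmaFinite lam]
    (m : Model Nα Nβ lam) (c : ℝ) (hc : 0 < c) :
    ∃ R : Set (State Nα Nβ → ℝ),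
      R ⊆ stdSimplex ℝ (State Nα Nβ) ∧
      Convex ℝ R ∧
      (∀ i : Fin Nβ, Pi.single (Sum.inr i) (1 : ℝ) ∈ R) ∧
      ∀ p₀ ∈ stdSimplex ℝ (Fin Nα),
      ∀ {Ω : Type*} [MeasurableSpace Ω] (P : Measure Ω) [IsProbabilityMeasure P]
        (ν : Ω → ℕ) (X : ℕ → Ω → State Nα Nβ) (y : ℕ → Ω → Y)
        (h : IsProcess m p₀ P ν X y) (Zhat : ℕ → Ω → State Nα Nβ → ℝ),
        IsPosterior P (obsFiltration y h.measurable_y) X Zhat →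
        IsStoppingTime (obsFiltration y h.measurable_y) (entryTime Zhat R) ∧
        ∀ τ : Ω → ℕ∞, IsStoppingTime (obsFiltration y h.measurable_y) τ →
          cost P c ν (entryTime Zhat R) ≤ cost P c ν τ := by
  refine ⟨m.stopRegion (ENNReal.ofReal c), fun p hp => hp.1, m.convex_stopRegion _,
    m.single_mem_stopRegion _, ?_⟩
  intro p₀ _ Ω _ P _ ν X y h Zhat hZ
  exact ⟨isStoppingTime_entryTime hZ.measurable (m.measurableSet_stopRegion _),
    fun τ hτ => h.cost_entryTime_le hZ c hτ⟩
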